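/- Let $X$ be a topological space and let $\mathcal S^\cdot=(\mathcal S^0\to\mathcal S^1\to\cdots)$ be a non-negative complex of sheaves of abelian groups on $X$. For an open covering $\mathcal U$ of $X$ let $\mathbb H^k(\mathcal U,\mathcal S^\cdot)$ be the $k$-th cohomology group of the total complex of the Čech double complex $C^p(\mathcal U,\mathcal S^q)=\prod_{i_0,\dots,i_p}\mathcal S^q(U_{i_0}\cap\dots\cap U_{i_p})$, and let $$\check{\mathbb H}^k(X,\mathcal S^\cdot)=\varinjlim_{\mathcal U}\mathbb H^k(\mathcal U,\mathcal S^\cdot)$$ be the Čech hypercohomology, the direct limit being taken over all open coverings of $X$, ordered by refinement. Let $\mathbb H^k(X,\mathcal S^\cdot)=H^k(\Gamma(X,\mathcal I^\cdot))$ be the derived hypercohomology, where $\mathcal S^\cdot\to\mathcal I^\cdot$ is a quasi-isomorphism to a non-negative complex of injective abelian sheaves. For every $\mathcal U$ restriction of sections induces an isomorphism $H^k(\Gamma(X,\mathcal I^\cdot))\cong\mathbb H^k(\mathcal U,\mathcal I^\cdot)$, and the maps $\mathbb H^k(\mathcal U,\mathcal S^\cdot)\to\mathbb H^k(\mathcal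 U,\mathcal I^\cdot)\cong H^k(\Gamma(X,\mathcal I^\cdot))$ induce in the limit the natural homomorphism $$\check{\mathbb H}^k(X,\mathcal S^\cdot)\to\mathbb H^k(X,\mathcal S^\cdot).$$ This homomorphism is bijective for $k\le 1$ and injective for $k=2$. -/

import Mathlib

open CategoryTheory TopologicalSpace Opposite Limits

universe u

noncomputable section

namespace CechHyper

/-- A first-quadrant double complex of abelian groups, with commuting differentials. -/
structure DoubleComplex where
  X : ℕ → ℕ → AddCommGrpCat.{u}
  δ (p q : ℕ) : X p q ⟶ X (p + 1) q
  d (p q : ℕ) : X p q ⟶ X p (q + 1)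
  δ_δ (p q : ℕ) : δ p q ≫ δ (p + 1) q = 0
  d_d (p q : ℕ) : d p q ≫ d p (q + 1) = 0
  comm (p q : ℕ) : δ p q ≫ d (p + 1) q = d p q ≫ δ p (q + 1)

namespace DoubleComplex

/-- Morphisms of double complexes. -/
@[ext]
structure Hom (K L : DoubleComplex.{u}) where
  f (p q : ℕ) : K.X p q ⟶ L.X p q
  comm_δ (p q : ℕ) : f p q ≫ L.δ p q = K.δ p q ≫ f (p + 1) q
  comm_d (p q : ℕ) : f p q ≫ L.d p q = K.d p q ≫ f p (q + 1)

instance : Category DoubleComplex.{u} where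
  Hom K L := Hom K L
  id K := { f := fun _ _ => 𝟙 _, comm_δ := by simp, comm_d := by simp }
  comp φ ψ :=
    { f := fun p q => φ.f p q ≫ ψ.f p q
      comm_δ := fun p q => by
        rw [Category.assoc, ψ.comm_δ, ← Category.assoc, φ.comm_δ, Category.assoc]
      comm_d := fun p q => by
        rw [Category.assoc, ψ.comm_d, ← Category.assoc, φ.comm_d, Category.assoc] }
  id_comp _ := Hom.ext (by funext p q; exact Category.id_comp _)
  comp_id _ := Hom.ext (by funext p q; exact Category.comp_id _)
  assoc _ _ _ := Hom.ext (by funext p q; exact Category.assoc _ _ _)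

variable (K : DoubleComplex.{u})

/-- The degree `n` part `⨁_{p + q = n} K^{p,q}` of the total complex: an element `z` has the
components `z ⟨(p, q), h⟩`, for `h : p + q = n`. -/
abbrev Tot (n : ℕ) : Type u := ∀ a : {a : ℕ × ℕ // a.1 + a.2 = n}, K.X a.1.1 a.1.2

/-- The `δ`-part of the total differential. -/
def totδ {n : ℕ} (z : K.Tot n) : K.Tot (n + 1)
  | ⟨(0, _), _⟩ => 0
  | ⟨(p + 1, q), h⟩ => K.δ p q (z ⟨(p, q), by dsimp only at h ⊢; omega⟩)

/-- The `d`-part of the total differential, with sign `(-1)^p`. -/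
def totd {n : ℕ} (z : K.Tot n) : K.Tot (n + 1)
  | ⟨(_, 0), _⟩ => 0
  | ⟨(p, q + 1), h⟩ => ((-1 : ℤ) ^ p) • K.d p q (z ⟨(p, q), by dsimp only at h ⊢; omega⟩)

/-- The total differential `D = δ + (-1)^p d`. -/
def totD (n : ℕ) : K.Tot n →+ K.Tot (n + 1) where
  toFun z := K.totδ z + K.totd z
  map_zero' := by
    funext ⟨⟨p, q⟩, h⟩
    rcases p with _ | p <;> rcases q with _ | q <;> simp [totδ, totd]
  map_add' z w := by
    funext ⟨⟨p, q⟩, h⟩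
    rcases p with _ | p <;> rcases q with _ | q <;> (simp [totδ, totd]; try abel)

lemma totD_apply {n : ℕ} (z : K.Tot n) (a) :
    K.totD n z a = K.totδ z a + K.totd z a := rfl

lemma δ_δ_apply (p q : ℕ) (x : K.X p q) : K.δ (p + 1) q (K.δ p q x) = 0 := by
  rw [← ConcreteCategory.comp_apply, K.δ_δ]; rfl

lemma d_d_apply (p q : ℕ) (x : K.X p q) : K.d p (q + 1) (K.d p q x) = 0 := by
  rw [← ConcreteCategory.comp_apply, K.d_d]; rfl

lemma comm_apply (p q : ℕ) (x : K.X p q) :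
    K.d (p + 1) q (K.δ p q x) = K.δ p (q + 1) (K.d p q x) := by
  rw [← ConcreteCategory.comp_apply, K.comm, ConcreteCategory.comp_apply]

lemma totD_totD {n : ℕ} (z : K.Tot n) : K.totD (n + 1) (K.totD n z) = 0 := by
  funext ⟨⟨p, q⟩, h⟩
  rcases p with _ | _ | p <;> rcases q with _ | _ | q <;>
    simp [totD_apply, totδ, totd, δ_δ_apply, d_d_apply, comm_apply, pow_succ]

/-- The total complex of a double complex. -/
def total : CochainComplex AddCommGrpCat.{u} ℕ :=
  CochainComplex.of (fun n => AddCommGrpCat.of (K.Tot n)) (fun n => AddCommGrpCat.ofHom (K.totD n))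
    (fun n => by
      ext z : 2
      exact K.totD_totD z)

lemma total_d (n : ℕ) : K.total.d n (n + 1) = AddCommGrpCat.ofHom (K.totD n) :=
  CochainComplex.of_d (fun n => AddCommGrpCat.of (K.Tot n))
    (fun n => AddCommGrpCat.ofHom (K.totD n)) n

/-- The map induced by a morphism of double complexes in degree `n` of the total complexes. -/
def totMap {K L : DoubleComplex.{u}} (φ : K ⟶ L) (n : ℕ) : K.Tot n →+ L.Tot n where
  toFun z a := φ.f a.1.1 a.1.2 (z a)
  map_zero' := by funext a; exact map_zero _
  map_add' z w := by funext a; exact map_add _ _ _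

lemma totD_totMap {K L : DoubleComplex.{u}} (φ : K ⟶ L) (n : ℕ) (z : K.Tot n) :
    L.totD n (totMap φ n z) = totMap φ (n + 1) (K.totD n z) := by
  funext ⟨⟨p, q⟩, h⟩
  have h1 := fun p q (x : K.X p q) => ConcreteCategory.congr_hom (φ.comm_δ p q) x
  have h2 := fun p q (x : K.X p q) => ConcreteCategory.congr_hom (φ.comm_d p q) x
  simp only [ConcreteCategory.comp_apply] at h1 h2
  rcases p with _ | p <;> rcases q with _ | q <;>
    simp [totD_apply, totδ, totd, totMap, h1, h2]

/-- The total complex as a functor. -/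
def totalFunctor : DoubleComplex.{u} ⥤ CochainComplex AddCommGrpCat.{u} ℕ where
  obj K := K.total
  map {K L} φ :=
    { f := fun n => AddCommGrpCat.ofHom (totMap φ n)
      comm' := by
        rintro n _ rfl
        rw [total_d, total_d]
        ext z : 2
        exact totD_totMap φ n z }
  map_id K := by
    ext n z
    rfl
  map_comp φ ψ := by
    ext n z
    rfl

end DoubleComplex

/-! ### Čech cochains -/

section Cech

variable {X : TopCat.{u}}

/-- Restriction of sections of an abelian sheaf. -/
def res (F : TopCat.Sheaf AddCommGrpCat.{u} X) {U V : Opens X} (h : V ≤ U) :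
    F.presheaf.obj (op U) →+ F.presheaf.obj (op V) :=
  (F.presheaf.map (homOfLE h).op).hom

lemma res_res (F : TopCat.Sheaf AddCommGrpCat.{u} X) {U V W : Opens X} (h : V ≤ U) (h' : W ≤ V)
    (s : F.presheaf.obj (op U)) : res F h' (res F h s) = res F (h'.trans h) s := by
  exact (ConcreteCategory.congr_hom (F.presheaf.map_comp (homOfLE h).op (homOfLE h').op) s).symm

lemma res_self (F : TopCat.Sheaf AddCommGrpCat.{u} X) {U : Opens X} (h : U ≤ U)
    (s : F.presheaf.obj (op U)) : res F h s = s :=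
  ConcreteCategory.congr_hom (F.presheaf.map_id (op U)) s

/-- The map on sections over `U` induced by a morphism of abelian sheaves. -/
def app {F G : TopCat.Sheaf AddCommGrpCat.{u} X} (φ : F ⟶ G) (U : Opens X) :
    F.presheaf.obj (op U) →+ G.presheaf.obj (op U) :=
  (φ.hom.app (op U)).hom

lemma app_res {F G : TopCat.Sheaf AddCommGrpCat.{u} X} (φ : F ⟶ G) {U V : Opens X} (h : V ≤ U)
    (s : F.presheaf.obj (op U)) : app φ V (res F h s) = res G h (app φ U s) :=
  ConcreteCategory.congr_hom (φ.hom.naturality (homOfLE h).op) s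

variable {ι : Type u} (U : ι → Opens X)

/-- The intersection `U_{i_0} ∩ ⋯ ∩ U_{i_p}`. -/
def inter {p : ℕ} (i : Fin (p + 1) → ι) : Opens X :=
  ⟨⋂ a, (U (i a) : Set X), isOpen_iInter_of_finite fun a => (U (i a)).isOpen⟩

lemma mem_inter {p : ℕ} {i : Fin (p + 1) → ι} {x : X} : x ∈ inter U i ↔ ∀ a, x ∈ U (i a) := by
  change x ∈ ⋂ a, (U (i a) : Set X) ↔ _
  simp

lemma inter_le_comp {p q : ℕ} (i : Fin (q + 1) → ι) (f : Fin (p + 1) → Fin (q + 1)) :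
    inter U i ≤ inter U (i ∘ f) :=
  fun _ hx => (mem_inter U).2 fun a => (mem_inter U).1 hx (f a)

variable (F : TopCat.Sheaf AddCommGrpCat.{u} X)

/-- Čech cochains `C^p(U, F) = ∏_{i_0, …, i_p} F(U_{i_0} ∩ ⋯ ∩ U_{i_p})`. -/
abbrev Cochain (p : ℕ) : Type u := ∀ i : Fin (p + 1) → ι, F.presheaf.obj (op (inter U i))

/-- The Čech coboundary
`(δ s)_{i_0 … i_{p+1}} = ∑_j (-1)^j s_{i_0 … î_j … i_{p+1}}|_{U_{i_0} ∩ ⋯ ∩ U_{i_{p+1}}}`. -/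
def coboundary (p : ℕ) : Cochain U F p →+ Cochain U F (p + 1) where
  toFun s i := ∑ j : Fin (p + 2),
    ((-1 : ℤ) ^ (j : ℕ)) • res F (inter_le_comp U i j.succAbove) (s (i ∘ j.succAbove))
  map_zero' := by
    funext i
    simp
  map_add' s t := by
    funext i
    simp [Finset.sum_add_distrib]

/-- The Čech cochains as a cosimplicial abelian group. -/
def cosimplicial : CosimplicialObject AddCommGrpCat.{u} where
  obj n := AddCommGrpCat.of (Cochain U F n.len)
  map {m n} f := AddCommGrpCat.ofHom
    { toFun := fun s i => res F (inter_le_comp U i f.toOrderHom) (s (i ∘ f.toOrderHom))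
      map_zero' := by funext i; exact map_zero _
      map_add' := fun s t => by funext i; exact map_add _ _ _ }
  map_id n := by
    ext s : 2
    funext i
    exact res_self F _ _
  map_comp f g := by
    ext s : 2
    funext i
    exact (res_res F _ _ _).symm

lemma coboundary_coboundary (p : ℕ) (s : Cochain U F p) :
    coboundary U F (p + 1) (coboundary U F p s) = 0 := by
  have key : ∀ p, AddCommGrpCat.ofHom (coboundary U F p) =
      AlgebraicTopology.AlternatingCofaceMapComplex.objD (cosimplicial U F) p := by
    intro p
    ext s : 2
    funext i
    let ev : ((cosimplicial U F).obj (.mk p) ⟶ (cosimplicial U F).obj (.mk (p + 1))) →+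
        F.presheaf.obj (op (inter U i)) :=
      { toFun := fun f => f.hom s i
        map_zero' := rfl
        map_add' := fun _ _ => rfl }
    change _ = ev _
    rw [AlgebraicTopology.AlternatingCofaceMapComplex.objD, map_sum]
    rfl
  have := AlgebraicTopology.AlternatingCofaceMapComplex.d_squared (cosimplicial U F) p
  rw [← key, ← key] at this
  exact ConcreteCategory.congr_hom this s

/-- The map on Čech cochains induced by a morphism of sheaves. -/
def cochainMap {F G : TopCat.Sheaf AddCommGrpCat.{u} X} (φ : F ⟶ G) (p : ℕ) :
    Cochain U F p →+ Cochain U G p where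
  toFun s i := app φ _ (s i)
  map_zero' := by funext i; exact map_zero _
  map_add' s t := by funext i; exact map_add _ _ _

lemma coboundary_cochainMap {F G : TopCat.Sheaf AddCommGrpCat.{u} X} (φ : F ⟶ G) (p : ℕ)
    (s : Cochain U F p) :
    coboundary U G p (cochainMap U φ p s) = cochainMap U φ (p + 1) (coboundary U F p s) := by
  funext i
  simp [coboundary, cochainMap, app_res]

/-- The Čech double complex `C^p(U, S^q)` of a non-negative complex of abelian sheaves. -/
def cechDouble (S : CochainComplex (TopCat.Sheaf AddCommGrpCat.{u} X) ℕ) : DoubleComplex.{u} where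
  X p q := AddCommGrpCat.of (Cochain U (S.X q) p)
  δ p q := AddCommGrpCat.ofHom (coboundary U (S.X q) p)
  d p q := AddCommGrpCat.ofHom (cochainMap U (S.d q (q + 1)) p)
  δ_δ p q := by
    ext s : 2
    exact coboundary_coboundary U _ p s
  d_d p q := by
    ext s : 2
    funext i
    exact ConcreteCategory.congr_hom (congrArg (fun φ => φ.hom.app (op (inter U i)))
      (S.d_comp_d q (q + 1) (q + 2))) (s i)
  comm p q := by
    ext s : 2
    exact (coboundary_cochainMap U _ p s).symm

/-- Functoriality of the Čech double complex in the complex of sheaves. -/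
def cechDoubleMap {S T : CochainComplex (TopCat.Sheaf AddCommGrpCat.{u} X) ℕ} (φ : S ⟶ T) :
    cechDouble U S ⟶ cechDouble U T where
  f p q := AddCommGrpCat.ofHom (cochainMap U (φ.f q) p)
  comm_δ p q := by
    ext s : 2
    exact coboundary_cochainMap U _ p s
  comm_d p q := by
    ext s : 2
    funext i
    exact ConcreteCategory.congr_hom (congrArg (fun φ => φ.hom.app (op (inter U i)))
      (φ.comm q (q + 1))) (s i)

variable {U} {κ : Type u} {V : κ → Opens X}

lemma inter_le_inter (τ : κ → ι) (hτ : ∀ k, V k ≤ U (τ k)) {p : ℕ} (i : Fin (p + 1) → κ) :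
    inter V i ≤ inter U (τ ∘ i) :=
  fun _ hx => (mem_inter U).2 fun a => hτ _ ((mem_inter V).1 hx a)

/-- The map on Čech double complexes induced by a refinement map `τ`, where `V_k ⊆ U_{τ(k)}`:
`s ↦ (s_{τ(k_0) … τ(k_p)}|_{V_{k_0} ∩ ⋯ ∩ V_{k_p}})`. -/
def cechDoubleRefine (S : CochainComplex (TopCat.Sheaf AddCommGrpCat.{u} X) ℕ)
    (τ : κ → ι) (hτ : ∀ k, V k ≤ U (τ k)) : cechDouble U S ⟶ cechDouble V S where
  f p q := AddCommGrpCat.ofHom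
    { toFun := fun (s : Cochain U (S.X q) p) i =>
        res (S.X q) (inter_le_inter τ hτ i) (s (τ ∘ i))
      map_zero' := by funext i; exact map_zero _
      map_add' := fun s t => by funext i; exact map_add _ _ _ }
  comm_δ p q := by
    ext s : 2
    funext i
    change coboundary V (S.X q) p _ i = res _ _ (coboundary U (S.X q) p s (τ ∘ i))
    simp only [coboundary, AddMonoidHom.coe_mk, ZeroHom.coe_mk, map_sum, map_zsmul, res_res]
    exact Finset.sum_congr rfl fun j _ => congrArg _ (res_res _ _ _ _)
  comm_d p q := by
    ext s : 2
    funext i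
    exact app_res (S.d q (q + 1)) _ _

end Cech

/-! ### Open coverings and Čech hypercohomology -/

/-- An open covering of `X`, given as a set of open subsets. -/
structure OpenCover (X : TopCat.{u}) where
  sets : Set (Opens X)
  exists_mem (x : X) : ∃ U ∈ sets, x ∈ U

namespace OpenCover

variable {X : TopCat.{u}}

/-- The members of a covering, indexed by themselves. -/
def family (𝒰 : OpenCover X) (i : 𝒰.sets) : Opens X := i.1

lemma exists_family (𝒰 : OpenCover X) (x : X) : ∃ i, x ∈ 𝒰.family i := by
  obtain ⟨U, hU, hx⟩ := 𝒰.exists_mem x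
  exact ⟨⟨U, hU⟩, hx⟩

/-- A refinement `𝒱 ⟶ 𝒰`: a map `τ` assigning to every member `V` of `𝒱` a member `τ(V)` of `𝒰`
such that `V ⊆ τ(V)`. -/
@[ext]
structure Refinement (𝒱 𝒰 : OpenCover X) where
  τ : 𝒱.sets → 𝒰.sets
  le_τ (V : 𝒱.sets) : 𝒱.family V ≤ 𝒰.family (τ V)

instance : SmallCategory (OpenCover X) where
  Hom 𝒱 𝒰 := Refinement 𝒱 𝒰
  id 𝒰 := ⟨id, fun _ => le_rfl⟩
  comp f g := ⟨g.τ ∘ f.τ, fun V => (f.le_τ V).trans (g.le_τ _)⟩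

end OpenCover

section Hyper

variable {X : TopCat.{u}}

/-- The total Čech complexes `C^·(𝒰, S^·)_tot`, as a functor in the covering `𝒰`. -/
def cechTotal (S : CochainComplex (TopCat.Sheaf AddCommGrpCat.{u} X) ℕ) :
    (OpenCover X)ᵒᵖ ⥤ CochainComplex AddCommGrpCat.{u} ℕ where
  obj 𝒰 := (cechDouble 𝒰.unop.family S).total
  map f := DoubleComplex.totalFunctor.map (cechDoubleRefine S f.unop.τ f.unop.le_τ)
  map_id 𝒰 := by
    ext n z : 3
    funext ⟨⟨p, q⟩, h⟩
    funext i
    exact res_self _ _ _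
  map_comp f g := by
    ext n z : 3
    funext ⟨⟨p, q⟩, h⟩
    funext i
    exact (res_res _ _ _ _).symm

/-- The functor `𝒰 ↦ ℍ^k(𝒰, S^·)`. -/
def coverHyper (S : CochainComplex (TopCat.Sheaf AddCommGrpCat.{u} X) ℕ) (k : ℕ) :
    (OpenCover X)ᵒᵖ ⥤ AddCommGrpCat.{u} :=
  cechTotal S ⋙ HomologicalComplex.homologyFunctor _ _ k

/-- Functoriality of the total Čech complexes in the complex of sheaves. -/
def cechTotalMap {S T : CochainComplex (TopCat.Sheaf AddCommGrpCat.{u} X) ℕ} (φ : S ⟶ T) :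
    cechTotal S ⟶ cechTotal T where
  app 𝒰 := DoubleComplex.totalFunctor.map (cechDoubleMap 𝒰.unop.family φ)
  naturality 𝒰 𝒱 f := by
    ext n z : 3
    funext ⟨⟨p, q⟩, h⟩
    funext i
    exact app_res (φ.f q) _ _

/-- The maps `ℍ^k(𝒰, S^·) ⟶ ℍ^k(𝒰, T^·)` induced by a morphism `S^· ⟶ T^·`. -/
def coverHyperMap {S T : CochainComplex (TopCat.Sheaf AddCommGrpCat.{u} X) ℕ} (φ : S ⟶ T) (k : ℕ) :
    coverHyper S k ⟶ coverHyper T k :=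
  Functor.whiskerRight (cechTotalMap φ) (HomologicalComplex.homologyFunctor _ _ k)

/-- Čech hypercohomology: the colimit of `ℍ^k(𝒰, S^·)` over all open coverings `𝒰` and all
refinements. (Two refinement maps `𝒱 ⟶ 𝒰` induce the same map in cohomology, so this is the
direct limit over the coverings preordered by refinement.) -/
def cechHyper (S : CochainComplex (TopCat.Sheaf AddCommGrpCat.{u} X) ℕ) (k : ℕ) :
    AddCommGrpCat.{u} :=
  colimit (coverHyper S k)

/-- The global sections functor on abelian sheaves. -/
abbrev globalSections (X : TopCat.{u}) :
    TopCat.Sheaf AddCommGrpCat.{u} X ⥤ AddCommGrpCat.{u} :=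
  (sheafSections (Opens.grothendieckTopology X) AddCommGrpCat.{u}).obj (op ⊤)

instance : (globalSections X).Additive where

end Hyper

lemma isIso_homologyMap_of_elements {K L : CochainComplex AddCommGrpCat.{u} ℕ} (f : K ⟶ L) (k : ℕ)
    (hs : ∀ z : L.X k, L.d k (k + 1) z = 0 →
      ∃ x : K.X k, K.d k (k + 1) x = 0 ∧ ∃ (j : ℕ) (y : L.X j), z - f.f k x = L.d j k y)
    (hi : ∀ x : K.X k, K.d k (k + 1) x = 0 → ∀ (j : ℕ) (y : L.X j), f.f k x = L.d j k y →
      ∃ (j : ℕ) (y : K.X j), x = K.d j k y) :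
    IsIso (HomologicalComplex.homologyMap f k) := by
  have hπ : ∀ (M : CochainComplex AddCommGrpCat.{u} ℕ),
      Function.Surjective (M.homologyπ k) := fun M =>
    (AddCommGrpCat.epi_iff_surjective _).1 inferInstance
  have hc : ∀ (M : CochainComplex AddCommGrpCat.{u} ℕ),
      Function.Injective (M.iCycles k) := fun M =>
    (AddCommGrpCat.mono_iff_injective _).1 inferInstance
  have hd : ∀ (M : CochainComplex AddCommGrpCat.{u} ℕ) (c : M.cycles k),
      M.d k (k + 1) (M.iCycles k c) = 0 := fun M c => by
    rw [← ConcreteCategory.comp_apply, HomologicalComplex.iCycles_d]; rfl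
  have hb : ∀ (M : CochainComplex AddCommGrpCat.{u} ℕ) (c : M.cycles k),
      M.homologyπ k c = 0 ↔ ∃ (j : ℕ) (y : M.X j), M.iCycles k c = M.d j k y := by
    intro M c
    constructor
    · intro h
      have := (ShortComplex.ab_exact_iff _).1 (ShortComplex.exact_of_g_is_cokernel
        (ShortComplex.mk _ _ (M.toCycles_comp_homologyπ _ k)) (M.homologyIsCokernel _ k rfl)) c h
      obtain ⟨y, hy⟩ := this
      refine ⟨_, y, ?_⟩
      rw [← hy]
      change (M.iCycles k) (M.toCycles _ k y) = _
      rw [← ConcreteCategory.comp_apply, HomologicalComplex.toCycles_i]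
    · rintro ⟨j, y, hy⟩
      have : c = M.toCycles j k y := by
        apply hc
        rw [hy, ← ConcreteCategory.comp_apply, HomologicalComplex.toCycles_i]
      rw [this, ← ConcreteCategory.comp_apply, HomologicalComplex.toCycles_comp_homologyπ]
      rfl
  have hmk : ∀ (M : CochainComplex AddCommGrpCat.{u} ℕ) (x : M.X k), M.d k (k + 1) x = 0 →
      ∃ c : M.cycles k, M.iCycles k c = x := fun M x hx =>
    (ShortComplex.ab_exact_iff _).1 (ShortComplex.exact_of_f_is_kernel
      (ShortComplex.mk _ _ (M.iCycles_d k (k + 1))) (M.cyclesIsKernel k (k + 1) (by simp))) x hx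
  have hf : ∀ c : K.cycles k, L.iCycles k (HomologicalComplex.cyclesMap f k c) =
      f.f k (K.iCycles k c) := fun c => by
    rw [← ConcreteCategory.comp_apply, HomologicalComplex.cyclesMap_i,
      ConcreteCategory.comp_apply]
  have hfπ : ∀ c : K.cycles k, HomologicalComplex.homologyMap f k (K.homologyπ k c) =
      L.homologyπ k (HomologicalComplex.cyclesMap f k c) := fun c => by
    rw [← ConcreteCategory.comp_apply, HomologicalComplex.homologyπ_naturality,
      ConcreteCategory.comp_apply]
  have : Mono (HomologicalComplex.homologyMap f k) := by
    rw [AddCommGrpCat.mono_iff_injective, injective_iff_map_eq_zero]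
    intro a ha
    obtain ⟨c, rfl⟩ := hπ K a
    rw [hfπ, hb, hf] at ha
    obtain ⟨j, y, hy⟩ := ha
    rw [hb]
    exact hi _ (hd K c) j y hy
  have : Epi (HomologicalComplex.homologyMap f k) := by
    rw [AddCommGrpCat.epi_iff_surjective]
    intro a
    obtain ⟨c, rfl⟩ := hπ L a
    obtain ⟨x, hx, j, y, hy⟩ := hs _ (hd L c)
    obtain ⟨e, rfl⟩ := hmk K x hx
    refine ⟨K.homologyπ k e, ?_⟩
    rw [hfπ, eq_comm, ← sub_eq_zero, ← map_sub, hb]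
    exact ⟨j, y, by rw [map_sub, hf, hy]⟩
  exact isIso_of_mono_of_epi _

/-- Staircase argument: if the rows of `K` are exact in positive degrees, then a total cochain
whose coboundary is concentrated in `p = 0` is, up to a total coboundary, concentrated in `p = 0`. -/
lemma DoubleComplex.exists_sub_totD (K : DoubleComplex.{u})
    (hK : ∀ (p q : ℕ) (z : K.X (p + 1) q), K.δ (p + 1) q z = 0 → ∃ w, K.δ p q w = z)
    {n : ℕ} (z : K.Tot (n + 1))
    (hz : ∀ p q h, K.totD (n + 1) z ⟨(p + 1, q), h⟩ = 0) :
    ∃ b : K.Tot n, ∀ p q h, (z - K.totD n b) ⟨(p + 1, q), h⟩ = 0 := by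
  suffices H : ∀ (m : ℕ) (z : K.Tot (n + 1)),
      (∀ p q h, K.totD (n + 1) z ⟨(p + 1, q), h⟩ = 0) →
      (∀ p q h, m < p → z ⟨(p, q), h⟩ = 0) →
      ∃ b : K.Tot n, ∀ p q h, (z - K.totD n b) ⟨(p + 1, q), h⟩ = 0 from
    H (n + 1) z hz (fun p q h hp => by dsimp only at h; omega)
  intro m
  induction m with
  | zero =>
    intro z _ hz'
    exact ⟨0, fun p q h => by simpa using hz' (p + 1) q h (by omega)⟩
  | succ m ih =>
    intro z hz hz'
    by_cases hm : m ≤ n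
    · obtain ⟨q, rfl⟩ := Nat.exists_eq_add_of_le hm
      have hcoc : K.δ (m + 1) q (z ⟨(m + 1, q), by dsimp only; omega⟩) = 0 := by
        have h1 := hz (m + 1) q (by dsimp only; omega)
        rw [K.totD_apply] at h1
        have h2 : K.totd z ⟨(m + 1 + 1, q), by dsimp only; omega⟩ = 0 := by
          rcases q with _ | q
          · rfl
          · simp only [DoubleComplex.totd]
            rw [hz' (m + 1 + 1) q _ (by omega)]
            simp
        rw [h2, add_zero] at h1
        exact h1
      obtain ⟨w, hw⟩ := hK m q _ hcoc
      let b : K.Tot (m + q) := Pi.single (M := fun a : {a : ℕ × ℕ // a.1 + a.2 = m + q} =>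
        (K.X a.1.1 a.1.2 : Type u)) ⟨(m, q), rfl⟩ w
      have hb : ∀ p' q' h', p' ≠ m → b ⟨(p', q'), h'⟩ = 0 := fun p' q' h' hp =>
        Pi.single_eq_of_ne (M := fun a : {a : ℕ × ℕ // a.1 + a.2 = m + q} =>
          (K.X a.1.1 a.1.2 : Type u)) (i := ⟨(m, q), rfl⟩) (i' := ⟨(p', q'), h'⟩) (by simp [hp]) w
      obtain ⟨b', hb'⟩ := ih (z - K.totD _ b)
        (fun p q h => by rw [map_sub, K.totD_totD, sub_zero]; exact hz p q h)
        (fun p' q' h' hp => by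
          have hd : K.totd b ⟨(p', q'), h'⟩ = 0 := by
            rcases q' with _ | q'
            · rfl
            · simp only [DoubleComplex.totd]
              rw [hb p' q' _ (by omega)]
              simp
          rw [Pi.sub_apply, K.totD_apply, hd, add_zero]
          rcases p' with _ | p'
          · omega
          · by_cases hpm : p' = m
            · subst hpm
              obtain rfl : q' = q := by dsimp only at h'; omega
              have : b ⟨(p', q'), rfl⟩ = w :=
                Pi.single_eq_same (M := fun a : {a : ℕ × ℕ // a.1 + a.2 = p' + q'} =>
                  (K.X a.1.1 a.1.2 : Type u)) ⟨(p', q'), rfl⟩ w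
              simp only [DoubleComplex.totδ]
              rw [this, hw, sub_self]
            · simp only [DoubleComplex.totδ]
              rw [hb p' q' _ hpm, hz' _ _ _ (by omega)]
              simp)
      refine ⟨b + b', fun p q h => ?_⟩
      rw [map_add, ← sub_sub]
      exact hb' p q h
    · exact ih z hz (fun p q h hp => by dsimp only at h; omega)

section Contraction

variable {X : TopCat.{u}}

/-- The sheaf of not necessarily continuous sections `U ↦ ∏_{x ∈ U} F_x`. -/
def godement (F : TopCat.Sheaf AddCommGrpCat.{u} X) : TopCat.Sheaf AddCommGrpCat.{u} X where
  obj :=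
    { obj := fun U => AddCommGrpCat.of (∀ x : U.unop, F.presheaf.stalk x.1)
      map := fun {U V} i => AddCommGrpCat.ofHom
        { toFun := fun s x => s ⟨x.1, i.unop.le x.2⟩
          map_zero' := rfl
          map_add' := fun _ _ => rfl } }
  property := by
    refine (TopCat.Presheaf.isSheaf_iff_isSheaf_comp' (forget AddCommGrpCat.{u}) _).2 ?_
    exact TopCat.Presheaf.toTypes_isSheaf X (fun x => F.presheaf.stalk x)

/-- The embedding of a sheaf in its Godement sheaf, given by the germs of a section. -/
def toGodement (F : TopCat.Sheaf AddCommGrpCat.{u} X) : F ⟶ godement F where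
  hom :=
    { app := fun U => AddCommGrpCat.ofHom
        { toFun := fun s x => F.presheaf.germ U.unop x.1 x.2 s
          map_zero' := by funext x; exact map_zero _
          map_add' := fun s t => by funext x; exact map_add _ _ _ }
      naturality := fun {U V} i => by
        ext s : 2
        funext x
        exact F.presheaf.germ_res_apply i.unop x.1 x.2 s }

instance (F : TopCat.Sheaf AddCommGrpCat.{u} X) : Mono (toGodement F) := by
  refine CategoryTheory.Sheaf.mono_of_injective _ fun U s t h => ?_
  refine TopCat.Presheaf.section_ext F U.unop s t fun x hx => ?_
  exact congrFun h ⟨x, hx⟩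

variable {ι : Type u} (U : ι → Opens X)

/-- The map `F(X) → C^0(U, F)` given by restriction. -/
def augZero (F : TopCat.Sheaf AddCommGrpCat.{u} X) :
    F.presheaf.obj (op (⊤ : Opens X)) →+ Cochain U F 0 where
  toFun s i := res F le_top s
  map_zero' := by funext i; exact map_zero _
  map_add' s t := by funext i; exact map_add _ _ _

lemma cochainMap_augZero {F G : TopCat.Sheaf AddCommGrpCat.{u} X} (φ : F ⟶ G)
    (s : F.presheaf.obj (op (⊤ : Opens X))) :
    cochainMap U φ 0 (augZero U F s) = augZero U G (app φ ⊤ s) := by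
  funext i
  exact app_res φ _ s

lemma coboundary_augZero (F : TopCat.Sheaf AddCommGrpCat.{u} X)
    (s : F.presheaf.obj (op (⊤ : Opens X))) : coboundary U F 0 (augZero U F s) = 0 := by
  funext i
  change ∑ j : Fin 2, ((-1 : ℤ) ^ (j : ℕ)) •
    res F (inter_le_comp U i j.succAbove) (res F le_top s) = 0
  rw [Fin.sum_univ_two, res_res, res_res]
  simp

variable {U}

/-- The value at `x` of a component of a Čech cochain of the Godement sheaf. -/
def gval {F : TopCat.Sheaf AddCommGrpCat.{u} X} {p : ℕ} (s : Cochain U (godement F) p)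
    (i : Fin (p + 1) → ι) (x : X) (hx : x ∈ inter U i) : F.presheaf.stalk x :=
  (show ∀ y : inter U i, F.presheaf.stalk y.1 from s i) ⟨x, hx⟩

lemma gval_congr {F : TopCat.Sheaf AddCommGrpCat.{u} X} {p : ℕ} (s : Cochain U (godement F) p)
    {i j : Fin (p + 1) → ι} (h : i = j) (x : X) (hx : x ∈ inter U i) (hx' : x ∈ inter U j) :
    gval s i x hx = gval s j x hx' := by
  subst h
  rfl

lemma gval_ext {F : TopCat.Sheaf AddCommGrpCat.{u} X} {p : ℕ} {s t : Cochain U (godement F) p}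
    (h : ∀ i x hx, gval s i x hx = gval t i x hx) : s = t := by
  funext i
  exact funext fun x : inter U i => h i x.1 x.2

lemma gval_coboundary {F : TopCat.Sheaf AddCommGrpCat.{u} X} {p : ℕ}
    (s : Cochain U (godement F) p) (i : Fin (p + 2) → ι) (x : X) (hx : x ∈ inter U i) :
    gval (coboundary U (godement F) p s) i x hx = ∑ j : Fin (p + 2),
      ((-1 : ℤ) ^ (j : ℕ)) • gval s (i ∘ j.succAbove) x (inter_le_comp U i j.succAbove hx) := by
  let ev : (godement F).presheaf.obj (op (inter U i)) →+ F.presheaf.stalk x :=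
    { toFun := fun t => (show ∀ y : inter U i, F.presheaf.stalk y.1 from t) ⟨x, hx⟩
      map_zero' := rfl
      map_add' := fun _ _ => rfl }
  change ev (∑ j : Fin (p + 2), _) = _
  rw [map_sum]
  rfl

lemma mem_inter_cons {p : ℕ} {i : Fin (p + 1) → ι} {x : X} (hx : x ∈ inter U i) {c : ι}
    (hc : x ∈ U c) : x ∈ inter U (Fin.cons c i : Fin (p + 2) → ι) := by
  rw [mem_inter]
  intro a
  refine Fin.cases ?_ (fun b => ?_) a
  · exact hc
  · exact (mem_inter U).1 hx b

lemma godement_exact (F : TopCat.Sheaf AddCommGrpCat.{u} X) (hU : ∀ x, ∃ i, x ∈ U i) (p : ℕ)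
    (s : Cochain U (godement F) (p + 1)) (hs : coboundary U _ _ s = 0) :
    ∃ t, coboundary U (godement F) p t = s := by
  choose c hc using hU
  let t : Cochain U (godement F) p := fun i =>
    (show ∀ x : inter U i, F.presheaf.stalk x.1 from
      fun x => gval s (Fin.cons (c x.1) i) x.1 (mem_inter_cons x.2 (hc x.1)))
  refine ⟨t, gval_ext fun i x hx => ?_⟩
  have h1 := gval_coboundary s (Fin.cons (c x) i) x (mem_inter_cons hx (hc x))
  rw [hs, Fin.sum_univ_succ] at h1
  change 0 = _ at h1
  rw [gval_coboundary, ← sub_eq_zero, ← neg_eq_zero, h1, neg_sub, sub_eq_add_neg,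
    ← Finset.sum_neg_distrib]
  congr 1
  · simp only [Fin.val_zero, pow_zero, one_smul]
    exact gval_congr s (by funext a; simp) x _ _
  · refine Finset.sum_congr rfl fun j _ => ?_
    rw [Fin.val_succ, pow_succ, mul_neg_one, neg_smul]
    congr 2
    refine gval_congr s ?_ x _ _
    funext a
    refine Fin.cases ?_ (fun b => ?_) a <;> simp

lemma godement_exact_zero (F : TopCat.Sheaf AddCommGrpCat.{u} X) (hU : ∀ x, ∃ i, x ∈ U i)
    (s : Cochain U (godement F) 0) (hs : coboundary U _ _ s = 0) :
    ∃ t, augZero U (godement F) t = s := by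
  choose c hc using hU
  have hmem : ∀ x, x ∈ inter U (fun _ : Fin 1 => c x) := fun x => (mem_inter U).2 fun _ => hc x
  refine ⟨(show ∀ x : (⊤ : Opens X), F.presheaf.stalk x.1 from
    fun x => gval s (fun _ => c x.1) x.1 (hmem x.1)), gval_ext fun i x hx => ?_⟩
  change gval s _ x _ = _
  have hx' : x ∈ inter U (Fin.cons (c x) i : Fin 2 → ι) := mem_inter_cons hx (hc x)
  have h1 := gval_coboundary s (Fin.cons (c x) i) x hx'
  rw [hs, Fin.sum_univ_two] at h1
  change 0 = _ at h1
  simp only [Fin.val_zero, pow_zero, one_smul, Fin.val_one, pow_one, neg_smul] at h1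
  rw [← sub_eq_add_neg, eq_comm, sub_eq_zero] at h1
  refine Eq.trans (gval_congr s ?_ x _ _) (h1.symm.trans (gval_congr s ?_ x _ _))
  · funext a
    fin_cases a
    rfl
  · funext a
    fin_cases a
    rfl

lemma augZero_injective (F : TopCat.Sheaf AddCommGrpCat.{u} X) (hU : ∀ x, ∃ i, x ∈ U i) : Function.Injective (augZero U F) := by
  intro s t h
  refine TopCat.Presheaf.section_ext F ⊤ s t fun x _ => ?_
  obtain ⟨i, hi⟩ := hU x
  have hx : x ∈ inter U (fun _ : Fin 1 => i) := (mem_inter U).2 fun _ => hi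
  have := congrArg (F.presheaf.germ _ x hx) (congrFun h fun _ => i)
  rw [← F.presheaf.germ_res_apply (homOfLE le_top) x hx s,
    ← F.presheaf.germ_res_apply (homOfLE le_top) x hx t]
  exact this

variable (F : TopCat.Sheaf AddCommGrpCat.{u} X) [Injective F]

/-- A retraction of the embedding of an injective sheaf in its Godement sheaf. -/
def godementRetract : godement F ⟶ F := Injective.factorThru (𝟙 F) (toGodement F)

lemma app_retract (V : Opens X) (s : F.presheaf.obj (op V)) :
    app (godementRetract F) V (app (toGodement F) V s) = s :=
  ConcreteCategory.congr_hom (congrArg (fun φ : F ⟶ F => φ.hom.app (op V))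
    (Injective.comp_factorThru (𝟙 F) (toGodement F))) s

lemma cochainMap_retract (p : ℕ) (s : Cochain U F p) :
    cochainMap U (godementRetract F) p (cochainMap U (toGodement F) p s) = s := by
  funext i
  exact app_retract F _ _

lemma injective_exact (hU : ∀ x, ∃ i, x ∈ U i) (p : ℕ)
    (s : Cochain U F (p + 1)) (hs : coboundary U _ _ s = 0) :
    ∃ t, coboundary U F p t = s := by
  obtain ⟨t, ht⟩ := godement_exact F hU p (cochainMap U (toGodement F) _ s)
    (by rw [coboundary_cochainMap, hs, map_zero])
  exact ⟨cochainMap U (godementRetract F) p t, by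
    rw [coboundary_cochainMap, ht, cochainMap_retract]⟩

lemma injective_exact_zero (hU : ∀ x, ∃ i, x ∈ U i)
    (s : Cochain U F 0) (hs : coboundary U _ _ s = 0) :
    ∃ t, augZero U F t = s := by
  obtain ⟨t, ht⟩ := godement_exact_zero F hU (cochainMap U (toGodement F) _ s)
    (by rw [coboundary_cochainMap, hs, map_zero])
  exact ⟨app (godementRetract F) ⊤ t, by
    rw [← cochainMap_augZero, ht, cochainMap_retract]⟩

end Contraction

section Comparison

variable {X : TopCat.{u}}

/-- The complex of global sections `Γ(X, S^·)`. -/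
abbrev Γ (S : CochainComplex (TopCat.Sheaf AddCommGrpCat.{u} X) ℕ) :
    CochainComplex AddCommGrpCat.{u} ℕ :=
  ((globalSections X).mapHomologicalComplex _).obj S

variable {ι : Type u} (U : ι → Opens X) (S : CochainComplex (TopCat.Sheaf AddCommGrpCat.{u} X) ℕ)

/-- The augmentation `Γ(X, S^n) → C^0(U, S^n) ⊆ C^·(U, S^·)_tot^n` in degree `n`, given by
restriction. -/
def augHom (n : ℕ) : (S.X n).presheaf.obj (op (⊤ : Opens X)) →+ (cechDouble U S).Tot n where
  toFun s
    | ⟨(0, q), h⟩ => augZero U (S.X q)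
        (app (S.XIsoOfEq (show n = q by dsimp only at h; omega)).hom ⊤ s)
    | ⟨(_ + 1, _), _⟩ => 0
  map_zero' := by
    funext ⟨⟨p, q⟩, h⟩
    rcases p with _ | p
    · exact (congrArg _ (map_zero _)).trans (map_zero _)
    · rfl
  map_add' s t := by
    funext ⟨⟨p, q⟩, h⟩
    rcases p with _ | p
    · exact (congrArg _ (map_add _ _ _)).trans (map_add _ _ _)
    · exact (add_zero _).symm

lemma augHom_zero (n : ℕ) (s : (S.X n).presheaf.obj (op (⊤ : Opens X))) (h : (0, n).1 + (0, n).2 = n) :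
    augHom U S n s ⟨(0, n), h⟩ = augZero U (S.X n) s := by
  change augZero U (S.X n) (app (S.XIsoOfEq rfl).hom ⊤ s) = _
  rw [HomologicalComplex.XIsoOfEq_rfl]
  rfl

lemma augHom_succ (n : ℕ) (s : (S.X n).presheaf.obj (op (⊤ : Opens X))) (p q : ℕ)
    (h : (p + 1, q).1 + (p + 1, q).2 = n) : augHom U S n s ⟨(p + 1, q), h⟩ = 0 := rfl

lemma totD_augHom (n : ℕ) (s : (S.X n).presheaf.obj (op (⊤ : Opens X))) :
    (cechDouble U S).totD n (augHom U S n s) =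
      augHom U S (n + 1) (app (S.d n (n + 1)) ⊤ s) := by
  funext ⟨⟨p, q⟩, h⟩
  rw [DoubleComplex.totD_apply]
  rcases p with _ | p
  · obtain rfl : q = n + 1 := by dsimp only at h; omega
    rw [augHom_zero]
    simp only [DoubleComplex.totδ, DoubleComplex.totd, zero_add, pow_zero, one_smul]
    rw [augHom_zero]
    exact cochainMap_augZero U _ s
  · rw [augHom_succ]
    have h2 : (cechDouble U S).totd (augHom U S n s) ⟨(p + 1, q), h⟩ = 0 := by
      rcases q with _ | q
      · rfl
      · simp only [DoubleComplex.totd]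
        rw [augHom_succ]
        simp
    rw [h2, add_zero]
    simp only [DoubleComplex.totδ]
    rcases p with _ | p
    · obtain rfl : q = n := by dsimp only at h; omega
      rw [augHom_zero]
      exact coboundary_augZero U _ s
    · rw [augHom_succ]
      simp

/-- The augmentation `Γ(X, S^·) ⟶ C^·(U, S^·)_tot`. -/
def aug : Γ S ⟶ (cechDouble U S).total where
  f n := AddCommGrpCat.ofHom (augHom U S n)
  comm' := by
    rintro n _ rfl
    rw [DoubleComplex.total_d]
    ext s : 2
    exact totD_augHom U S n s

lemma isIso_homologyMap_aug (hS : ∀ q, Injective (S.X q)) (hU : ∀ x, ∃ i, x ∈ U i) (k : ℕ) :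
    IsIso (HomologicalComplex.homologyMap (aug U S) k) := by
  have hex : ∀ (p q : ℕ) (z : (cechDouble U S).X (p + 1) q),
      (cechDouble U S).δ (p + 1) q z = 0 → ∃ w, (cechDouble U S).δ p q w = z :=
    fun p q z hz => injective_exact (S.X q) hU p z hz
  -- a total cochain concentrated in `p = 0` with coboundary concentrated in `p = 0` is global
  have key : ∀ (n : ℕ) (z : (cechDouble U S).Tot n),
      (∀ p q h, z ⟨(p + 1, q), h⟩ = 0) →
      (∀ p q h, (cechDouble U S).totD n z ⟨(p + 1, q), h⟩ = 0) →
      ∃ x, augHom U S n x = z := by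
    intro n z hz hDz
    obtain ⟨x, hx⟩ := injective_exact_zero (S.X n) hU (z ⟨(0, n), by simp⟩) (by
      have h1 := hDz 0 n (by simp; omega)
      rw [DoubleComplex.totD_apply] at h1
      have h2 : (cechDouble U S).totd z ⟨(0 + 1, n), by simp; omega⟩ = 0 := by
        rcases n with _ | n
        · rfl
        · simp only [DoubleComplex.totd]
          rw [hz]
          simp
      rw [h2, add_zero] at h1
      exact h1)
    refine ⟨x, ?_⟩
    funext ⟨⟨p, q⟩, h⟩
    rcases p with _ | p
    · obtain rfl : q = n := by dsimp only at h; omega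
      rw [augHom_zero, hx]
    · rw [augHom_succ, hz]
  have hinj : ∀ n, Function.Injective (augHom U S n) := fun n s t h => by
    refine augZero_injective (S.X n) hU ?_
    have := congrFun h ⟨(0, n), by simp⟩
    rwa [augHom_zero, augHom_zero] at this
  apply isIso_homologyMap_of_elements
  · intro (z : (cechDouble U S).Tot k) hz
    rw [DoubleComplex.total_d] at hz
    change (cechDouble U S).totD k z = 0 at hz
    obtain ⟨z', hz', j, y, hy⟩ : ∃ z' : (cechDouble U S).Tot k,
        (∀ p q h, z' ⟨(p + 1, q), h⟩ = 0) ∧ ∃ (j : ℕ) (y : (cechDouble U S).total.X j),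
          z - z' = (cechDouble U S).total.d j k y := by
      rcases k with _ | k
      · exact ⟨z, fun p q h => by dsimp only at h; omega, 0, 0,
          (sub_self z).trans (map_zero ((cechDouble U S).total.d 0 0).hom).symm⟩
      · obtain ⟨b, hb⟩ := (cechDouble U S).exists_sub_totD hex z
          (fun p q h => by rw [hz]; rfl)
        refine ⟨_, hb, k, b, ?_⟩
        rw [DoubleComplex.total_d, sub_sub_cancel]
        rfl
    have hDz' : (cechDouble U S).totD k z' = 0 := by
      have h1 : (cechDouble U S).total.d k (k + 1) ((cechDouble U S).total.d j k y) = 0 := by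
        rw [← ConcreteCategory.comp_apply, HomologicalComplex.d_comp_d]
        rfl
      rw [← hy, DoubleComplex.total_d] at h1
      change (cechDouble U S).totD k (z - z') = 0 at h1
      rwa [map_sub, hz, zero_sub, neg_eq_zero] at h1
    obtain ⟨x, hx⟩ := key k z' hz' (fun p q h => by rw [hDz']; rfl)
    refine ⟨x, ?_, j, y, ?_⟩
    · apply hinj (k + 1)
      refine Eq.trans ((totD_augHom U S k x).symm.trans ?_) (map_zero (augHom U S (k + 1))).symm
      rw [hx, hDz']
    · rw [← hy]
      exact congrArg (z - ·) hx
  · intro (x : (S.X k).presheaf.obj (op (⊤ : Opens X))) hx j y hy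
    by_cases hjk : j + 1 = k
    · subst hjk
      rw [DoubleComplex.total_d] at hy
      change augHom U S (j + 1) x = (cechDouble U S).totD j y at hy
      obtain ⟨y', hy', hD⟩ : ∃ y' : (cechDouble U S).Tot j,
          (∀ p q h, y' ⟨(p + 1, q), h⟩ = 0) ∧
            (cechDouble U S).totD j y' = (cechDouble U S).totD j y := by
        rcases j with _ | j
        · exact ⟨y, fun p q h => by dsimp only at h; omega, rfl⟩
        · obtain ⟨b, hb⟩ := (cechDouble U S).exists_sub_totD hex y
            (fun p q h => by rw [← hy]; rfl)
          refine ⟨_, hb, ?_⟩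
          refine (map_sub ((cechDouble U S).totD (j + 1)) _ _).trans ?_
          rw [DoubleComplex.totD_totD]
          exact sub_zero _
      obtain ⟨w, hw⟩ := key j y' hy' (fun p q h => by rw [hD, ← hy]; rfl)
      refine ⟨j, w, hinj _ ?_⟩
      rw [hy, ← hD, ← hw]
      exact totD_augHom U S j w
    · rw [HomologicalComplex.shape _ _ _ hjk] at hy
      have hx0 : x = 0 := hinj k (Eq.trans hy (map_zero (augHom U S k)).symm)
      exact ⟨0, 0, hx0.trans (map_zero ((Γ S).d 0 k).hom).symm⟩

variable {U} {κ : Type u} {V : κ → Opens X}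

lemma aug_refine (τ : κ → ι) (hτ : ∀ k, V k ≤ U (τ k)) :
    aug U S ≫ DoubleComplex.totalFunctor.map (cechDoubleRefine S τ hτ) = aug V S := by
  ext n s : 3
  funext ⟨⟨p, q⟩, h⟩
  rcases p with _ | p
  · funext i
    exact res_res _ _ _ _
  · funext i
    exact map_zero (res (S.X q) (inter_le_inter τ hτ i))

/-- An injective resolution of a non-negative complex `S` of abelian sheaves: a quasi-isomorphism
from `S` to a non-negative complex of injective abelian sheaves. -/
structure InjRes (S : CochainComplex (TopCat.Sheaf AddCommGrpCat.{u} X) ℕ) where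
  I : CochainComplex (TopCat.Sheaf AddCommGrpCat.{u} X) ℕ
  injective (q : ℕ) : Injective (I.X q)
  η : S ⟶ I
  quasiIso : QuasiIso η

/-- Injective resolutions exist. -/
instance : Nonempty (InjRes S) := by
  let e := ComplexShape.embeddingUpIntGE 0
  have : CochainComplex.IsStrictlyGE (S.extend e) 0 :=
    inferInstanceAs ((S.extend e).IsStrictlySupported e)
  obtain ⟨L, i, hi, hL, hL'⟩ :=
    CochainComplex.Plus.modelCategoryQuillen.exists_quasiIso_injective (S.extend e) 0
  have hlift : e.HasLift (𝟙 (L.restriction e)) := by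
    intro j hj i' hij
    have : L.d i' (e.f j) = 0 :=
      (L.isZero_X_of_isStrictlySupported e i'
        (fun k hk => hj.2 k (by rw [hk]; exact hij))).eq_of_src _ _
    rw [this]
    exact zero_comp
  let t := e.liftExtend (𝟙 (L.restriction e)) hlift
  have ht : IsIso t := by
    have : ∀ n, IsIso (t.f n) := fun n => by
      by_cases h : ∃ k, e.f k = n
      · obtain ⟨k, hk⟩ := h
        rw [e.isIso_liftExtend_f_iff _ _ hk]
        infer_instance
      · push Not at h
        exact ⟨0, (L.isZero_X_of_isStrictlySupported e n h).eq_of_src _ _,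
          (HomologicalComplex.isZero_X_of_isStrictlySupported _ e n h).eq_of_src _ _⟩
    exact HomologicalComplex.Hom.isIso_of_components t
  let φ := (e.fullyFaithfulExtendFunctor _).preimage (i ≫ t)
  have hφ : HomologicalComplex.extendMap φ e = i ≫ t :=
    (e.fullyFaithfulExtendFunctor _).map_preimage (i ≫ t)
  refine ⟨⟨L.restriction e, fun q => hL _, φ, ?_⟩⟩
  rw [← HomologicalComplex.quasiIso_extendMap_iff φ e, hφ]
  infer_instance

variable {S}

/-- Derived hypercohomology `ℍ^k(X, S^·) = H^k(Γ(X, I^·))`, computed by an injective resolution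
`I` of `S`. -/
def derivedHyper (R : InjRes S) (k : ℕ) : AddCommGrpCat.{u} := (Γ R.I).homology k

/-- For a covering `𝒰` and an injective resolution `I`, the isomorphism
`H^k(Γ(X, I^·)) ≅ ℍ^k(𝒰, I^·)` induced by the augmentation. -/
def augIso (R : InjRes S) (k : ℕ) (𝒰 : OpenCover X) :
    derivedHyper R k ≅ (coverHyper R.I k).obj (op 𝒰) :=
  @asIso _ _ _ _ (HomologicalComplex.homologyMap (aug 𝒰.family R.I) k)
    (isIso_homologyMap_aug 𝒰.family R.I R.injective 𝒰.exists_family k)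

/-- For a covering `𝒰`, the composition `ℍ^k(𝒰, S^·) ⟶ ℍ^k(𝒰, I^·) ≅ H^k(Γ(X, I^·))`. -/
def coverToDerived (R : InjRes S) (k : ℕ) (𝒰 : OpenCover X) :
    (coverHyper S k).obj (op 𝒰) ⟶ derivedHyper R k :=
  (coverHyperMap R.η k).app (op 𝒰) ≫ (augIso R k 𝒰).inv

lemma coverToDerived_refine (R : InjRes S) (k : ℕ) {𝒰 𝒱 : OpenCover X} (f : 𝒱 ⟶ 𝒰) :
    (coverHyper S k).map f.op ≫ coverToDerived R k 𝒱 = coverToDerived R k 𝒰 := by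
  have h : (augIso R k 𝒰).hom ≫ (coverHyper R.I k).map f.op = (augIso R k 𝒱).hom :=
    (HomologicalComplex.homologyMap_comp _ _ _).symm.trans
      (congrArg (HomologicalComplex.homologyMap · k) (aug_refine R.I f.τ f.le_τ))
  rw [coverToDerived, coverToDerived, NatTrans.naturality_assoc]
  congr 1
  rw [Iso.comp_inv_eq, ← h, Iso.inv_hom_id_assoc]

/-- The natural homomorphism from Čech hypercohomology to derived hypercohomology: the map induced
on the colimit by the compositions `ℍ^k(𝒰, S^·) ⟶ ℍ^k(𝒰, I^·) ≅ H^k(Γ(X, I^·))`. -/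
def cechToDerived (R : InjRes S) (k : ℕ) : cechHyper S k ⟶ derivedHyper R k :=
  colimit.desc (coverHyper S k)
    { pt := derivedHyper R k
      ι :=
        { app := fun 𝒰 => coverToDerived R k 𝒰.unop
          naturality := fun _ _ f => by
            rw [← Quiver.Hom.op_unop f, coverToDerived_refine]
            exact (Category.comp_id _).symm } }

end Comparison

end CechHyper

end

noncomputable section

/-!
Let `𝒞` be the mapping cone of the resolution `𝒮 ⟶ ℐ`, shifted so that it starts in degree `0`; it
is an exact complex of sheaves. As the sections over an open set are left exact, the columns of the
Čech double complex of `𝒞` are exact in degrees `0` and `1` for every covering, and hence a total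
cocycle of degree `n ≤ 2` is a total coboundary as soon as its component in
`C^0(𝒰, 𝒞^n) = ∏ 𝒞^n(U_i)` is the differential of a cochain. The latter holds after a refinement of
the covering, because `𝒞` is exact. So the hypercohomology of `𝒞` vanishes in degrees `≤ 2` in the
limit, and the theorem follows from the long exact sequence of the cone. There, elements are needed
only in the following form: if `z` is a cocycle of `𝒮` and `y` a cochain of `ℐ` whose coboundary is
the image of `z`, then `(z, y)` is a cocycle of the cone, and a primitive of `(z, y)` consists of a
cochain `v` of `𝒮` with coboundary `z` and of a cochain of `ℐ` whose coboundary is the difference of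
`y` and the image of `v`. Injectivity is the existence of `v`; surjectivity is the case `z = 0`.
-/

namespace CechHyper

section HomologyClass

variable {M N : CochainComplex AddCommGrpCat.{u} ℕ} {k i : ℕ}

lemma exists_iCycles_eq (x : M.X k) (hx : M.d k (k + 1) x = 0) :
    ∃ c : M.cycles k, M.iCycles k c = x :=
  (ShortComplex.ab_exact_iff _).1 (ShortComplex.exact_of_f_is_kernel
    (ShortComplex.mk _ _ (M.iCycles_d k (k + 1))) (M.cyclesIsKernel k (k + 1) (by simp))) x hx

lemma iCycles_injective : Function.Injective (M.iCycles k) :=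
  (AddCommGrpCat.mono_iff_injective _).1 inferInstance

lemma d_iCycles (c : M.cycles k) : M.d k (k + 1) (M.iCycles k c) = 0 := by
  rw [← ConcreteCategory.comp_apply, HomologicalComplex.iCycles_d]
  rfl

variable (M) in
/-- The class in `H^k(M)` of a `k`-cocycle, which is given as an element of `M^k` rather than of
the object of cycles so that it can be computed with. -/
def homologyClass (x : M.X k) (hx : M.d k (k + 1) x = 0) : M.homology k :=
  M.homologyπ k (exists_iCycles_eq x hx).choose

lemma homologyClass_iCycles (c : M.cycles k) :
    homologyClass M (M.iCycles k c) (d_iCycles c) = M.homologyπ k c :=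
  congrArg (M.homologyπ k) (iCycles_injective (exists_iCycles_eq _ (d_iCycles c)).choose_spec)

lemma exists_homologyClass_eq (a : M.homology k) : ∃ x hx, homologyClass M (k := k) x hx = a := by
  obtain ⟨c, rfl⟩ := (AddCommGrpCat.epi_iff_surjective (M.homologyπ k)).1 inferInstance a
  exact ⟨_, d_iCycles c, homologyClass_iCycles c⟩

lemma homologyπ_eq_zero_iff (hi : (ComplexShape.up ℕ).prev k = i) (c : M.cycles k) :
    M.homologyπ k c = 0 ↔ ∃ y : M.X i, M.toCycles i k y = c := by
  refine ⟨(ShortComplex.ab_exact_iff _).1 (ShortComplex.exact_of_g_is_cokernel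
    (ShortComplex.mk _ _ (M.toCycles_comp_homologyπ _ k)) (M.homologyIsCokernel i k hi)) c, ?_⟩
  rintro ⟨y, rfl⟩
  rw [← ConcreteCategory.comp_apply, HomologicalComplex.toCycles_comp_homologyπ]
  rfl

/-- For `k = 0` the previous degree is `0` itself, and `M.d 0 0 = 0`. -/
lemma homologyClass_eq_zero_iff (hi : (ComplexShape.up ℕ).prev k = i) (x : M.X k)
    (hx : M.d k (k + 1) x = 0) : homologyClass M x hx = 0 ↔ ∃ y : M.X i, x = M.d i k y := by
  obtain ⟨c, rfl⟩ := exists_iCycles_eq x hx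
  rw [homologyClass_iCycles, homologyπ_eq_zero_iff hi]
  refine exists_congr fun y => ?_
  rw [← M.toCycles_i i k, ConcreteCategory.comp_apply, iCycles_injective.eq_iff, eq_comm]

lemma homologyClass_sub (x y : M.X k) (hx : M.d k (k + 1) x = 0) (hy : M.d k (k + 1) y = 0) :
    homologyClass M (x - y) (by rw [map_sub, hx, hy, sub_zero]) =
      homologyClass M x hx - homologyClass M y hy := by
  obtain ⟨c, rfl⟩ := exists_iCycles_eq x hx
  obtain ⟨e, rfl⟩ := exists_iCycles_eq y hy
  simpa only [map_sub, homologyClass_iCycles] using homologyClass_iCycles (c - e)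

lemma homologyClass_eq_iff (hi : (ComplexShape.up ℕ).prev k = i) (x y : M.X k)
    (hx : M.d k (k + 1) x = 0) (hy : M.d k (k + 1) y = 0) :
    homologyClass M x hx = homologyClass M y hy ↔ ∃ w : M.X i, x - y = M.d i k w := by
  rw [← sub_eq_zero, ← homologyClass_sub, homologyClass_eq_zero_iff hi]

lemma hom_f_d_apply (f : M ⟶ N) (i j : ℕ) (x : M.X i) :
    f.f j (M.d i j x) = N.d i j (f.f i x) := by
  rw [← ConcreteCategory.comp_apply, ← f.comm, ConcreteCategory.comp_apply]

lemma d_hom_f_eq_zero (f : M ⟶ N) (x : M.X k) (hx : M.d k (k + 1) x = 0) :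
    N.d k (k + 1) (f.f k x) = 0 := by
  rw [← hom_f_d_apply, hx, map_zero]

lemma homologyMap_homologyClass (f : M ⟶ N) (x : M.X k) (hx : M.d k (k + 1) x = 0) :
    HomologicalComplex.homologyMap f k (homologyClass M x hx) =
      homologyClass N (f.f k x) (d_hom_f_eq_zero f x hx) := by
  obtain ⟨c, rfl⟩ := exists_iCycles_eq x hx
  have h : f.f k (M.iCycles k c) = N.iCycles k (HomologicalComplex.cyclesMap f k c) := by
    rw [← ConcreteCategory.comp_apply, ← HomologicalComplex.cyclesMap_i,
      ConcreteCategory.comp_apply]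
  simp only [h, homologyClass_iCycles]
  rw [← ConcreteCategory.comp_apply, HomologicalComplex.homologyπ_naturality,
    ConcreteCategory.comp_apply]

variable (f : M ⟶ N) [QuasiIso f]

lemma homologyMap_bijective (k : ℕ) :
    Function.Bijective (HomologicalComplex.homologyMap f k) :=
  ConcreteCategory.bijective_of_isIso _

lemma eq_zero_of_quasiIso (t : M.X 0) (ht : M.d 0 1 t = 0) (hft : f.f 0 t = 0) : t = 0 := by
  have h : homologyClass M t ht = 0 := by
    apply (homologyMap_bijective f 0).1
    rw [homologyMap_homologyClass, map_zero, homologyClass_eq_zero_iff (i := 0) (by simp)]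
    exact ⟨0, by rw [hft, map_zero]⟩
  obtain ⟨y, rfl⟩ := (homologyClass_eq_zero_iff (i := 0) (by simp) _ _).1 h
  rw [M.shape 0 0 (by simp)]
  rfl

lemma exists_eq_d_of_quasiIso (hi : (ComplexShape.up ℕ).prev k = i) (t : M.X (k + 1)) (u : N.X k)
    (ht : M.d (k + 1) (k + 2) t = 0) (h : f.f (k + 1) t = N.d k (k + 1) u) :
    ∃ (v : M.X k) (w : N.X i), t = M.d k (k + 1) v ∧ u = f.f k v + N.d i k w := by
  have hk : (ComplexShape.up ℕ).prev (k + 1) = k := by simp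
  have class_t : homologyClass M t ht = 0 := by
    apply (homologyMap_bijective f (k + 1)).1
    rw [homologyMap_homologyClass, map_zero, homologyClass_eq_zero_iff hk]
    exact ⟨u, h⟩
  obtain ⟨v, rfl⟩ := (homologyClass_eq_zero_iff hk t ht).1 class_t
  have hu : N.d k (k + 1) (u - f.f k v) = 0 := by
    rw [map_sub, ← h, hom_f_d_apply, sub_self]
  obtain ⟨a, ha⟩ := (homologyMap_bijective f k).2 (homologyClass N _ hu)
  obtain ⟨v', hv', rfl⟩ := exists_homologyClass_eq a
  rw [homologyMap_homologyClass, eq_comm, homologyClass_eq_iff hi] at ha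
  obtain ⟨w, hw⟩ := ha
  refine ⟨v + v', w, by rw [map_add, hv', add_zero], ?_⟩
  rw [map_add, ← hw]
  abel

end HomologyClass

namespace DoubleComplex

lemma neg_one_pow_smul_cancel {A : Type*} [AddCommGroup A] (p : ℕ) (x : A) :
    (-1 : ℤ) ^ p • (-1 : ℤ) ^ p • x = x := by
  rw [smul_smul, ← mul_pow, neg_one_mul, neg_neg, one_pow, one_smul]

lemma total_d_apply {K : DoubleComplex.{u}} {n : ℕ} (z : K.Tot n) :
    K.total.d n (n + 1) z = K.totD n z := by
  rw [total_d]
  rfl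

section ColumnFiltration

variable {C : DoubleComplex.{u}}

/-- The subgroup of those `z` in `Tot n` whose components `z^{p,q}` with `p < m` vanish: the
filtration whose associated graded pieces are the columns of `C`. -/
def columnFiltration (C : DoubleComplex.{u}) (n m : ℕ) : AddSubgroup (C.Tot n) where
  carrier := {z | ∀ a, a.1.1 < m → z a = 0}
  zero_mem' _ _ := rfl
  add_mem' hz hw a ha := by rw [Pi.add_apply, hz a ha, hw a ha, add_zero]
  neg_mem' hz a ha := by rw [Pi.neg_apply, hz a ha, neg_zero]

lemma mem_columnFiltration_zero {n : ℕ} (z : C.Tot n) : z ∈ columnFiltration C n 0 :=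
  fun a ha => absurd ha a.1.1.not_lt_zero

lemma mem_columnFiltration_succ {n m q : ℕ} (h : m + q = n) {z : C.Tot n}
    (hz : z ∈ columnFiltration C n m) (hzm : z ⟨(m, q), h⟩ = 0) :
    z ∈ columnFiltration C n (m + 1) := by
  rintro ⟨⟨p, q'⟩, h' : p + q' = n⟩ (hp : p < m + 1)
  obtain hp | rfl := Nat.lt_succ_iff_lt_or_eq.1 hp
  · exact hz _ hp
  · obtain rfl : q' = q := by omega
    exact hzm

lemma columnFiltration_eq_bot {n m : ℕ} (h : n < m) : columnFiltration C n m = ⊥ :=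
  (AddSubgroup.eq_bot_iff_forall _).2 fun _ hz => funext fun a => hz a (by have := a.2; omega)

lemma totD_apply_succ_of_mem_columnFiltration {n m q : ℕ} (h : m + q = n) {z : C.Tot n}
    (hz : z ∈ columnFiltration C n m) :
    C.totD n z ⟨(m, q + 1), by dsimp only; omega⟩ = (-1 : ℤ) ^ m • C.d m q (z ⟨(m, q), h⟩) := by
  rw [totD_apply]
  cases m with
  | zero => exact zero_add _
  | succ p =>
    change C.δ p (q + 1) (z ⟨(p, q + 1), _⟩) + _ = _
    rw [hz _ p.lt_succ_self, map_zero, zero_add]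
    rfl

lemma totD_mem_columnFiltration {n m : ℕ} {z : C.Tot n} (hz : z ∈ columnFiltration C n m) :
    C.totD n z ∈ columnFiltration C (n + 1) m := by
  rintro ⟨⟨p, q⟩, h⟩ (hp : p < m)
  have hδ : C.totδ z ⟨(p, q), h⟩ = 0 := by
    cases p with
    | zero => rfl
    | succ p => exact (congrArg (C.δ p q) (hz _ (Nat.lt_of_succ_lt hp))).trans (map_zero _)
  have hd : C.totd z ⟨(p, q), h⟩ = 0 := by
    cases q with
    | zero => rfl
    | succ q =>
      change _ • C.d p q (z ⟨(p, q), _⟩) = 0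
      rw [hz _ hp, map_zero, smul_zero]
  rw [totD_apply, hδ, hd, add_zero]

lemma d_eq_zero_of_mem_columnFiltration {n m q : ℕ} (h : m + q = n) {z : C.Tot n}
    (hz : z ∈ columnFiltration C n m) (hDz : C.totD n z = 0) : C.d m q (z ⟨(m, q), h⟩) = 0 := by
  have := (totD_apply_succ_of_mem_columnFiltration h hz).symm.trans (congrFun hDz _)
  rwa [Pi.zero_apply, (isUnit_one.neg.pow m).smul_eq_zero] at this

lemma exists_sub_totD_mem_columnFiltration {n m q : ℕ} (h : m + q = n) {z : C.Tot (n + 1)}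
    (hz : z ∈ columnFiltration C (n + 1) m)
    (hzd : ∃ w, C.d m q w = z ⟨(m, q + 1), by dsimp only; omega⟩) :
    ∃ b, z - C.totD n b ∈ columnFiltration C (n + 1) (m + 1) := by
  obtain ⟨w, hw⟩ := hzd
  let b : C.Tot n := Pi.single (M := fun a : {a : ℕ × ℕ // a.1 + a.2 = n} => C.X a.1.1 a.1.2)
    ⟨(m, q), h⟩ ((-1 : ℤ) ^ m • w)
  have hb : b ∈ columnFiltration C n m := fun a ha =>
    Pi.single_eq_of_ne (by rintro rfl; exact ha.ne rfl) _
  refine ⟨b, mem_columnFiltration_succ (q := q + 1) (by omega)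
    (sub_mem hz (totD_mem_columnFiltration hb)) ?_⟩
  have hbm : b ⟨(m, q), h⟩ = (-1 : ℤ) ^ m • w := Pi.single_eq_same _ _
  rw [Pi.sub_apply, totD_apply_succ_of_mem_columnFiltration h hb, hbm, map_zsmul,
    neg_one_pow_smul_cancel, hw, sub_self]

lemma exists_totD_eq_of_mem_columnFiltration {n : ℕ} (hinj : ∀ p x, C.d p 0 x = 0 → x = 0)
    (hex : ∀ p q, q < n → ∀ x, C.d p (q + 1) x = 0 → ∃ w, C.d p q w = x) (q : ℕ) :
    ∀ {m : ℕ}, 0 < m → m + q = n + 1 → ∀ z ∈ columnFiltration C (n + 1) m,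
      C.totD (n + 1) z = 0 → ∃ b, C.totD n b = z := by
  induction q with
  | zero =>
    intro m _ h z hz hDz
    have hz' := mem_columnFiltration_succ h hz
      (hinj m _ (d_eq_zero_of_mem_columnFiltration h hz hDz))
    rw [columnFiltration_eq_bot (by omega), AddSubgroup.mem_bot] at hz'
    exact ⟨0, (map_zero _).trans hz'.symm⟩
  | succ q ih =>
    intro m hm h z hz hDz
    obtain ⟨b, hb⟩ := exists_sub_totD_mem_columnFiltration (q := q) (by omega) hz
      (hex m q (by omega) _ (d_eq_zero_of_mem_columnFiltration h hz hDz))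
    obtain ⟨b', hb'⟩ := ih m.succ_pos (by omega) _ hb (by rw [map_sub, hDz, totD_totD, sub_zero])
    exact ⟨b' + b, by rw [map_add, hb', sub_add_cancel]⟩

/-- Only the corner component `z^{0,n+1}` has to be a `d`-boundary by assumption: the corrections of
the later ones take place in the range where the columns are exact. -/
lemma exists_totD_eq {n : ℕ} (hinj : ∀ p x, C.d p 0 x = 0 → x = 0)
    (hex : ∀ p q, q < n → ∀ x, C.d p (q + 1) x = 0 → ∃ w, C.d p q w = x) (z : C.Tot (n + 1))
    (hDz : C.totD (n + 1) z = 0) (hz : ∃ w, C.d 0 n w = z ⟨(0, n + 1), by dsimp only; omega⟩) :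
    ∃ b, C.totD n b = z := by
  obtain ⟨b, hb⟩ := exists_sub_totD_mem_columnFiltration (zero_add n)
    (mem_columnFiltration_zero z) hz
  obtain ⟨b', hb'⟩ := exists_totD_eq_of_mem_columnFiltration hinj hex n one_pos (by omega) _ hb
    (by rw [map_sub, hDz, totD_totD, sub_zero])
  exact ⟨b' + b, by rw [map_add, hb', sub_add_cancel]⟩

end ColumnFiltration

section Cone

variable {K L : DoubleComplex.{u}}

lemma f_δ_apply (φ : K ⟶ L) (p q : ℕ) (x : K.X p q) :
    φ.f (p + 1) q (K.δ p q x) = L.δ p q (φ.f p q x) :=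
  (ConcreteCategory.congr_hom (φ.comm_δ p q) x).symm

lemma f_d_apply (φ : K ⟶ L) (p q : ℕ) (x : K.X p q) :
    φ.f p (q + 1) (K.d p q x) = L.d p q (φ.f p q x) :=
  (ConcreteCategory.congr_hom (φ.comm_d p q) x).symm

/-- The mapping cone of `φ` with respect to the differentials `d`, shifted so that it lives in the
first quadrant: its columns are `K^{p,0} ⟶ K^{p,1} × L^{p,0} ⟶ K^{p,2} × L^{p,1} ⟶ ⋯`, with
differential `(x, y) ↦ (d x, φ x - d y)`. -/
def cone (φ : K ⟶ L) : DoubleComplex.{u} where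
  X
    | p, 0 => K.X p 0
    | p, q + 1 => AddCommGrpCat.of (K.X p (q + 1) × L.X p q)
  δ
    | p, 0 => K.δ p 0
    | p, q + 1 => AddCommGrpCat.ofHom ((K.δ p (q + 1)).hom.prodMap (L.δ p q).hom)
  d
    | p, 0 => AddCommGrpCat.ofHom ((K.d p 0).hom.prod (φ.f p 0).hom)
    | p, q + 1 => AddCommGrpCat.ofHom
        (((K.d p (q + 1)).hom.comp (AddMonoidHom.fst _ _)).prod
          ((φ.f p (q + 1)).hom.coprod (-(L.d p q).hom)))
  δ_δ
    | p, 0 => K.δ_δ p 0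
    | p, q + 1 => by
      ext x : 2
      exact Prod.ext (K.δ_δ_apply p (q + 1) x.1) (L.δ_δ_apply p q x.2)
  d_d
    | p, 0 => by
      ext x : 2
      refine Prod.ext (K.d_d_apply p 0 x) ?_
      change φ.f p 1 (K.d p 0 x) + -L.d p 0 (φ.f p 0 x) = 0
      rw [f_d_apply, add_neg_cancel]
    | p, q + 1 => by
      ext x : 2
      refine Prod.ext (K.d_d_apply p (q + 1) x.1) ?_
      change φ.f p (q + 2) (K.d p (q + 1) x.1) +
        -L.d p (q + 1) (φ.f p (q + 1) x.1 + -L.d p q x.2) = 0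
      rw [f_d_apply, map_add, map_neg, d_d_apply, neg_zero, add_zero, add_neg_cancel]
  comm
    | p, 0 => by
      ext x : 2
      exact Prod.ext (K.comm_apply p 0 x) (f_δ_apply φ p 0 x)
    | p, q + 1 => by
      ext x : 2
      refine Prod.ext (K.comm_apply p (q + 1) x.1) ?_
      change φ.f (p + 1) (q + 1) (K.δ p (q + 1) x.1) + -L.d (p + 1) q (L.δ p q x.2) =
        L.δ p (q + 1) (φ.f p (q + 1) x.1 + -L.d p q x.2)
      rw [f_δ_apply, comm_apply, map_add, map_neg]

variable (φ : K ⟶ L) {n : ℕ}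

/-- The projection of the mapping cone onto `K`. -/
def coneFst : cone φ ⟶ K where
  f
    | _, 0 => 𝟙 _
    | _, _ + 1 => AddCommGrpCat.ofHom (AddMonoidHom.fst _ _)
  comm_δ
    | _, 0 => rfl
    | _, _ + 1 => rfl
  comm_d
    | _, 0 => rfl
    | _, _ + 1 => rfl

variable {φ}

/-- The `L`-part of a total cochain of the mapping cone. The signs turn the total differential of
the cone into `(z, y) ↦ (D z, φ z - D y)`. -/
def coneSnd (c : (cone φ).Tot (n + 1)) : L.Tot n := fun a =>
  (-1 : ℤ) ^ a.1.1 • (c ⟨(a.1.1, a.1.2 + 1), congrArg (· + 1) a.2⟩).2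

variable (φ) in
/-- The total cochain of the mapping cone with prescribed `K`-part `z` and `L`-part `y`. -/
def conePair (z : K.Tot (n + 1)) (y : L.Tot n) : (cone φ).Tot (n + 1)
  | ⟨(p, 0), h⟩ => z ⟨(p, 0), h⟩
  | ⟨(p, q + 1), h⟩ => (z ⟨(p, q + 1), h⟩, (-1 : ℤ) ^ p • y ⟨(p, q), Nat.succ.inj h⟩)

lemma conePair_zero_succ (z : K.Tot (n + 1)) (y : L.Tot n) :
    conePair φ z y ⟨(0, n + 1), zero_add _⟩ =
      (z ⟨(0, n + 1), zero_add _⟩, y ⟨(0, n), zero_add _⟩) :=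
  Prod.ext rfl (one_smul ℤ _)

lemma totMap_coneFst_conePair (z : K.Tot (n + 1)) (y : L.Tot n) :
    totMap (coneFst φ) (n + 1) (conePair φ z y) = z := by
  funext ⟨⟨p, q⟩, h⟩
  cases q <;> rfl

lemma coneSnd_conePair (z : K.Tot (n + 1)) (y : L.Tot n) : coneSnd (conePair φ z y) = y :=
  funext fun a => neg_one_pow_smul_cancel a.1.1 (y a)

lemma tot_cone_ext {c c' : (cone φ).Tot (n + 1)}
    (hfst : totMap (coneFst φ) (n + 1) c = totMap (coneFst φ) (n + 1) c')
    (hsnd : coneSnd c = coneSnd c') : c = c' := by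
  funext ⟨⟨p, q⟩, h⟩
  have hfst := congrFun hfst ⟨(p, q), h⟩
  cases q with
  | zero => exact hfst
  | succ q =>
    refine Prod.ext hfst ?_
    have hsnd := congrArg ((-1 : ℤ) ^ p • ·) (congrFun hsnd ⟨(p, q), Nat.succ.inj h⟩)
    exact (neg_one_pow_smul_cancel p _).symm.trans (hsnd.trans (neg_one_pow_smul_cancel p _))

lemma coneSnd_add (c c' : (cone φ).Tot (n + 1)) : coneSnd (c + c') = coneSnd c + coneSnd c' :=
  funext fun _ => smul_add _ _ _

lemma coneSnd_totδ (c : (cone φ).Tot (n + 1)) :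
    coneSnd ((cone φ).totδ c) = -L.totδ (coneSnd c) := by
  funext ⟨⟨p, q⟩, h⟩
  cases p with
  | zero => exact (smul_zero _).trans neg_zero.symm
  | succ p =>
    change (-1 : ℤ) ^ (p + 1) • L.δ p q (c ⟨(p, q + 1), _⟩).2 =
      -L.δ p q ((-1 : ℤ) ^ p • (c ⟨(p, q + 1), _⟩).2)
    rw [map_zsmul, pow_succ, mul_neg_one, neg_smul]

lemma coneSnd_totd (c : (cone φ).Tot (n + 1)) :
    coneSnd ((cone φ).totd c) =
      totMap φ (n + 1) (totMap (coneFst φ) (n + 1) c) - L.totd (coneSnd c) := by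
  funext ⟨⟨p, q⟩, h⟩
  cases q with
  | zero => exact (neg_one_pow_smul_cancel p _).trans (sub_zero _).symm
  | succ q =>
    change (-1 : ℤ) ^ p • (-1 : ℤ) ^ p •
        (φ.f p (q + 1) (c ⟨(p, q + 1), h⟩).1 + -L.d p q (c ⟨(p, q + 1), h⟩).2) =
      φ.f p (q + 1) (c ⟨(p, q + 1), h⟩).1 -
        (-1 : ℤ) ^ p • L.d p q ((-1 : ℤ) ^ p • (c ⟨(p, q + 1), h⟩).2)
    rw [map_zsmul, neg_one_pow_smul_cancel, neg_one_pow_smul_cancel, sub_eq_add_neg]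

lemma coneSnd_totD_succ (c : (cone φ).Tot (n + 1)) :
    coneSnd ((cone φ).totD (n + 1) c) =
      totMap φ (n + 1) (totMap (coneFst φ) (n + 1) c) - L.totD n (coneSnd c) := by
  change coneSnd ((cone φ).totδ c + (cone φ).totd c) = _ - (L.totδ _ + L.totd _)
  rw [coneSnd_add, coneSnd_totδ, coneSnd_totd]
  abel

lemma coneSnd_totD_zero (c : (cone φ).Tot 0) :
    coneSnd ((cone φ).totD 0 c) = totMap φ 0 (totMap (coneFst φ) 0 c) := by
  funext ⟨⟨p, q⟩, h⟩
  obtain ⟨rfl, rfl⟩ : p = 0 ∧ q = 0 := by simpa using h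
  refine (one_smul ℤ _).trans ?_
  change (0 + (-1 : ℤ) ^ 0 • (K.d 0 0 _, φ.f 0 0 (c ⟨(0, 0), h⟩)) : K.X 0 1 × L.X 0 0).2 = _
  rw [zero_add, pow_zero, one_smul]
  rfl

lemma totD_conePair_eq_zero {z : K.Tot (n + 1)} {y : L.Tot n} (hz : K.totD (n + 1) z = 0)
    (hzy : totMap φ (n + 1) z = L.totD n y) : (cone φ).totD (n + 1) (conePair φ z y) = 0 := by
  refine tot_cone_ext ?_ ?_
  · rw [← totD_totMap, totMap_coneFst_conePair, hz, map_zero]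
  · rw [coneSnd_totD_succ, totMap_coneFst_conePair, coneSnd_conePair, hzy, sub_self]
    exact funext fun a => (smul_zero _).symm

lemma exists_eq_totD_of_totD_eq_conePair {i : ℕ} (hi : (ComplexShape.up ℕ).prev n = i)
    {z : K.Tot (n + 1)} {y : L.Tot n} {b : (cone φ).Tot n}
    (hb : (cone φ).totD n b = conePair φ z y) :
    ∃ (v : K.Tot n) (w : L.total.X i), z = K.totD n v ∧ y - totMap φ n v = L.total.d i n w := by
  have hz : z = K.totD n (totMap (coneFst φ) n b) := by
    rw [totD_totMap, hb, totMap_coneFst_conePair]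
  have hy : y = coneSnd ((cone φ).totD n b) := by rw [hb, coneSnd_conePair]
  cases n with
  | zero =>
    refine ⟨_, 0, hz, ?_⟩
    rw [hy, coneSnd_totD_zero, sub_self, map_zero]
    rfl
  | succ n =>
    obtain rfl : n = i := by simpa using hi
    refine ⟨_, -coneSnd b, hz, ?_⟩
    rw [hy, coneSnd_totD_succ, sub_sub_cancel_left, total_d]
    exact (map_neg (L.totD n) _).symm

end Cone

end DoubleComplex

section Local

variable {X : TopCat.{u}}

lemma germ_res (F : TopCat.Sheaf AddCommGrpCat.{u} X) {U V : Opens X} (h : V ≤ U) {x : X}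
    (hx : x ∈ V) (s : F.presheaf.obj (op U)) :
    F.presheaf.germ V x hx (res F h s) = F.presheaf.germ U x (h hx) s :=
  F.presheaf.germ_res_apply (homOfLE h) x hx s

lemma exists_res_eq_of_germ_eq (F : TopCat.Sheaf AddCommGrpCat.{u} X) {U : Opens X} {x : X}
    (hx : x ∈ U) {s t : F.presheaf.obj (op U)}
    (h : F.presheaf.germ U x hx s = F.presheaf.germ U x hx t) :
    ∃ (V : Opens X) (hV : V ≤ U), x ∈ V ∧ res F hV s = res F hV t := by
  obtain ⟨V, hxV, i, _, hij⟩ := F.presheaf.germ_eq x hx hx s t h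
  exact ⟨V, i.le, hxV, hij⟩

lemma exists_res_eq (F : TopCat.Sheaf AddCommGrpCat.{u} X) {ι : Type u} {V : ι → Opens X}
    {U : Opens X} (hV : ∀ i, V i ≤ U) (hU : U ≤ iSup V) (s : ∀ i, F.presheaf.obj (op (V i)))
    (hs : ∀ i j, res F (inf_le_left : V i ⊓ V j ≤ V i) (s i) = res F inf_le_right (s j)) :
    ∃ t : F.presheaf.obj (op U), ∀ i, res F (hV i) t = s i :=
  (TopCat.Sheaf.existsUnique_gluing' F V U (fun i => homOfLE (hV i)) hU s hs).exists

lemma eq_of_res_eq (F : TopCat.Sheaf AddCommGrpCat.{u} X) {ι : Type u} {V : ι → Opens X}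
    {U : Opens X} (hV : ∀ i, V i ≤ U) (hU : U ≤ iSup V) {s t : F.presheaf.obj (op U)}
    (h : ∀ i, res F (hV i) s = res F (hV i) t) : s = t :=
  TopCat.Sheaf.eq_of_locally_eq' F V U (fun i => homOfLE (hV i)) hU s t h

/-- The complex of stalks at `x` of a complex of abelian sheaves, as a functor. -/
abbrev stalkComplex (x : X) :
    CochainComplex (TopCat.Sheaf AddCommGrpCat.{u} X) ℕ ⥤ CochainComplex AddCommGrpCat.{u} ℕ :=
  (TopCat.Sheaf.forget AddCommGrpCat.{u} X ⋙
    TopCat.Presheaf.stalkFunctor AddCommGrpCat.{u} x).mapHomologicalComplex _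

lemma germ_app {F G : TopCat.Sheaf AddCommGrpCat.{u} X} (φ : F ⟶ G) {U : Opens X} {x : X}
    (hx : x ∈ U) (s : F.presheaf.obj (op U)) :
    G.presheaf.germ U x hx (app φ U s) =
      (TopCat.Presheaf.stalkFunctor AddCommGrpCat.{u} x).map φ.hom (F.presheaf.germ U x hx s) :=
  (TopCat.Presheaf.stalkFunctor_map_germ_apply U x hx φ.hom s).symm

variable {S I : CochainComplex (TopCat.Sheaf AddCommGrpCat.{u} X) ℕ} (η : S ⟶ I)

/-- The sections `(t, u)` of `S^{k+1} × I^k` form a cocycle of the mapping cone of `η`. -/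
structure IsConeCocycle (k : ℕ) {U : Opens X} (t : (S.X (k + 1)).presheaf.obj (op U))
    (u : (I.X k).presheaf.obj (op U)) : Prop where
  app_d_eq_zero : app (S.d (k + 1) (k + 2)) U t = 0
  app_η_eq : app (η.f (k + 1)) U t = app (I.d k (k + 1)) U u

/-- The sections `(t, u)` of `S^{k+1} × I^k` form a boundary of the mapping cone of `η`. Here `i` is
the degree before `k`; for `k = 0` this is `i = 0`, and the term with `I.d 0 0 = 0` disappears. -/
def IsConeBoundary (i k : ℕ) {U : Opens X} (t : (S.X (k + 1)).presheaf.obj (op U))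
    (u : (I.X k).presheaf.obj (op U)) : Prop :=
  ∃ (v : (S.X k).presheaf.obj (op U)) (w : (I.X i).presheaf.obj (op U)),
    t = app (S.d k (k + 1)) U v ∧ u = app (η.f k) U v + app (I.d i k) U w

variable {η} {i k : ℕ}

lemma IsConeBoundary.res {U V : Opens X} (h : V ≤ U) {t : (S.X (k + 1)).presheaf.obj (op U)}
    {u : (I.X k).presheaf.obj (op U)} (htu : IsConeBoundary η i k t u) :
    IsConeBoundary η i k (res _ h t) (res _ h u) := by
  obtain ⟨v, w, rfl, rfl⟩ := htu
  exact ⟨CechHyper.res _ h v, CechHyper.res _ h w, (app_res _ h v).symm, by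
    rw [map_add, app_res, app_res]⟩

lemma exists_isConeBoundary_of_germ_eq {U : Opens X} {t : (S.X (k + 1)).presheaf.obj (op U)}
    {u : (I.X k).presheaf.obj (op U)} {v : (S.X k).presheaf.obj (op U)}
    {w : (I.X i).presheaf.obj (op U)} {x : X} (hx : x ∈ U)
    (ht : (S.X (k + 1)).presheaf.germ U x hx t =
      (S.X (k + 1)).presheaf.germ U x hx (app (S.d k (k + 1)) U v))
    (hu : (I.X k).presheaf.germ U x hx u =
      (I.X k).presheaf.germ U x hx (app (η.f k) U v + app (I.d i k) U w)) :
    ∃ (V : Opens X) (hV : V ≤ U), x ∈ V ∧ IsConeBoundary η i k (res _ hV t) (res _ hV u) := by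
  obtain ⟨V₁, hV₁, hx₁, h₁⟩ := exists_res_eq_of_germ_eq _ hx ht
  obtain ⟨V₂, hV₂, hx₂, h₂⟩ := exists_res_eq_of_germ_eq _ hx hu
  have hle₁ : V₁ ⊓ V₂ ≤ V₁ := inf_le_left
  have hle₂ : V₁ ⊓ V₂ ≤ V₂ := inf_le_right
  refine ⟨V₁ ⊓ V₂, hle₁.trans hV₁, ⟨hx₁, hx₂⟩, ?_⟩
  rw [← res_res _ hV₁ hle₁ t, h₁, ← res_res _ hV₂ hle₂ u, h₂, res_res, res_res]
  exact IsConeBoundary.res _ ⟨v, w, rfl, rfl⟩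

variable [QuasiIso η]

lemma section_eq_zero_of_quasiIso {U : Opens X} (t : (S.X 0).presheaf.obj (op U))
    (ht : app (S.d 0 1) U t = 0) (hηt : app (η.f 0) U t = 0) : t = 0 := by
  refine TopCat.Presheaf.section_ext (S.X 0) U t 0 fun x hx => ?_
  refine (eq_zero_of_quasiIso ((stalkComplex x).map η) ((S.X 0).presheaf.germ U x hx t)
    ?_ ?_).trans (map_zero ((S.X 0).presheaf.germ U x hx).hom).symm
  · refine (germ_app (S.d 0 1) hx t).symm.trans ?_
    rw [ht]
    exact map_zero ((S.X 1).presheaf.germ U x hx).hom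
  · refine (germ_app (η.f 0) hx t).symm.trans ?_
    rw [hηt]
    exact map_zero ((I.X 0).presheaf.germ U x hx).hom

lemma section_eq_of_quasiIso {U : Opens X} {s t : (S.X 0).presheaf.obj (op U)}
    (hd : app (S.d 0 1) U s = app (S.d 0 1) U t) (hη : app (η.f 0) U s = app (η.f 0) U t) :
    s = t :=
  sub_eq_zero.1 <| section_eq_zero_of_quasiIso (η := η) _ (by rw [map_sub, hd, sub_self])
    (by rw [map_sub, hη, sub_self])

lemma IsConeCocycle.exists_isConeBoundary (hi : (ComplexShape.up ℕ).prev k = i) {U : Opens X}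
    {t : (S.X (k + 1)).presheaf.obj (op U)} {u : (I.X k).presheaf.obj (op U)}
    (h : IsConeCocycle η k t u) (x : X) (hx : x ∈ U) :
    ∃ (V : Opens X) (hV : V ≤ U), x ∈ V ∧ IsConeBoundary η i k (res _ hV t) (res _ hV u) := by
  obtain ⟨v, w, hv, hw⟩ := exists_eq_d_of_quasiIso ((stalkComplex x).map η) hi
    ((S.X (k + 1)).presheaf.germ U x hx t) ((I.X k).presheaf.germ U x hx u)
    (by
      refine (germ_app (S.d (k + 1) (k + 2)) hx t).symm.trans ?_
      rw [h.app_d_eq_zero]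
      exact map_zero ((S.X (k + 2)).presheaf.germ U x hx).hom)
    (by
      refine (germ_app (η.f (k + 1)) hx t).symm.trans ?_
      rw [h.app_η_eq]
      exact germ_app (I.d k (k + 1)) hx u)
  obtain ⟨V₁, hV₁, hx₁, v, rfl⟩ := (S.X k).presheaf.exists_le_germ_eq v hx
  obtain ⟨V₂, hV₂, hx₂, w, rfl⟩ := (I.X i).presheaf.exists_le_germ_eq w hx₁
  obtain ⟨V, hV, hxV, hB⟩ := exists_isConeBoundary_of_germ_eq (η := η) hx₂
    (t := res _ (hV₂.trans hV₁) t) (u := res _ (hV₂.trans hV₁) u) (v := res _ hV₂ v) (w := w)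
    (by
      rw [germ_res, germ_app, germ_res]
      exact hv)
    (by
      rw [map_add, germ_res, germ_app, germ_app, germ_res]
      exact hw)
  rw [res_res, res_res] at hB
  exact ⟨V, _, hxV, hB⟩

/-- In the lowest degree the local primitives are unique, hence glue. -/
lemma IsConeCocycle.isConeBoundary_zero {U : Opens X} {t : (S.X 1).presheaf.obj (op U)}
    {u : (I.X 0).presheaf.obj (op U)} (h : IsConeCocycle η 0 t u) :
    IsConeBoundary η 0 0 t u := by
  choose V hV hxV v w hv hu using fun x : U => h.exists_isConeBoundary (i := 0) (by simp) x.1 x.2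
  have d_zero_zero : ∀ W (w : (I.X 0).presheaf.obj (op W)), app (I.d 0 0) W w = 0 := by
    intro W w
    rw [I.shape 0 0 (by simp)]
    rfl
  simp only [d_zero_zero, add_zero] at hu
  have hU : U ≤ iSup V := fun x hx => Opens.mem_iSup.2 ⟨⟨x, hx⟩, hxV _⟩
  obtain ⟨s, hs⟩ := exists_res_eq (S.X 0) hV hU v fun x y =>
    section_eq_of_quasiIso (η := η) (by simp only [app_res, ← hv, res_res])
      (by simp only [app_res, ← hu, res_res])
  refine ⟨s, 0, eq_of_res_eq (S.X 1) hV hU fun x => ?_, eq_of_res_eq (I.X 0) hV hU fun x => ?_⟩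
  · rw [← app_res, hs, hv]
  · rw [map_zero, add_zero, ← app_res, hs, hu]

end Local

section CechCone

variable {X : TopCat.{u}} {ι : Type u} {U : ι → Opens X}
  {S I : CochainComplex (TopCat.Sheaf AddCommGrpCat.{u} X) ℕ} {η : S ⟶ I} {i k p : ℕ}

open DoubleComplex

lemma exists_cone_d_eq (hi : (ComplexShape.up ℕ).prev k = i) {t : Cochain U (S.X (k + 1)) p}
    {u : Cochain U (I.X k) p} (h : ∀ j, IsConeBoundary η i k (t j) (u j)) :
    ∃ w, (cone (cechDoubleMap U η)).d p k w = (t, u) := by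
  choose v w hv hw using h
  cases k with
  | zero =>
    refine ⟨v, Prod.ext (funext fun j => (hv j).symm) (funext fun j => ((hw j).trans ?_).symm)⟩
    rw [I.shape i 0 (by simp)]
    exact add_zero (app (η.f 0) _ (v j))
  | succ k =>
    obtain rfl : k = i := by simpa using hi
    refine ⟨(v, -w), Prod.ext (funext fun j => (hv j).symm)
      (funext fun j => ((hw j).trans ?_).symm)⟩
    change _ = app (η.f (k + 1)) _ (v j) + -app (I.d k (k + 1)) _ (-w j)
    rw [map_neg, neg_neg]

lemma isConeCocycle_of_cone_d_eq_zero {c : (cone (cechDoubleMap U η)).X p (k + 1)}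
    (hc : (cone (cechDoubleMap U η)).d p (k + 1) c = 0) (j : Fin (p + 1) → ι) :
    IsConeCocycle η k (c.1 j) (c.2 j) where
  app_d_eq_zero := congrFun (congrArg Prod.fst hc) j
  app_η_eq := eq_of_sub_eq_zero <|
    (sub_eq_add_neg _ _).trans (congrFun (congrArg Prod.snd hc) j)

lemma isConeCocycle_of_totD {z : (cechDouble U S).Tot (k + 1)} {y : (cechDouble U I).Tot k}
    (hz : (cechDouble U S).totD (k + 1) z = 0)
    (hzy : totMap (cechDoubleMap U η) (k + 1) z = (cechDouble U I).totD k y)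
    (j : Fin 1 → ι) :
    IsConeCocycle η k (z ⟨(0, k + 1), zero_add _⟩ j) (y ⟨(0, k), zero_add _⟩ j) := by
  refine isConeCocycle_of_cone_d_eq_zero (U := U) (p := 0)
    (c := (z ⟨(0, k + 1), zero_add _⟩, y ⟨(0, k), zero_add _⟩)) ?_ j
  have := d_eq_zero_of_mem_columnFiltration (m := 0) (zero_add (k + 1))
    (mem_columnFiltration_zero _) (totD_conePair_eq_zero hz hzy)
  rwa [conePair_zero_succ] at this

variable [QuasiIso η]

lemma eq_zero_of_cone_d_eq_zero {x : (cone (cechDoubleMap U η)).X p 0}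
    (hx : (cone (cechDoubleMap U η)).d p 0 x = 0) : x = 0 :=
  funext fun j => section_eq_zero_of_quasiIso (η := η) _
    (congrFun (congrArg Prod.fst hx) j) (congrFun (congrArg Prod.snd hx) j)

lemma eq_zero_of_totMap_cechDoubleMap_eq_zero {z : (cechDouble U S).Tot 0}
    (hz : (cechDouble U S).totD 0 z = 0) (h : totMap (cechDoubleMap U η) 0 z = 0) : z = 0 := by
  have d_eq_zero : (cechDouble U S).d 0 0 (z ⟨(0, 0), rfl⟩) = 0 :=
    d_eq_zero_of_mem_columnFiltration rfl (mem_columnFiltration_zero z) hz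
  have z_zero_eq_zero : z ⟨(0, 0), rfl⟩ = 0 := funext fun j =>
    section_eq_zero_of_quasiIso (η := η) _ (congrFun d_eq_zero j)
      (congrFun (congrFun h ⟨(0, 0), rfl⟩) j)
  funext ⟨⟨p, q⟩, hpq⟩
  obtain ⟨rfl, rfl⟩ : p = 0 ∧ q = 0 := by simpa using hpq
  exact z_zero_eq_zero

lemma exists_eq_totD_of_isConeBoundary (hk : k ≤ 1) (hi : (ComplexShape.up ℕ).prev k = i)
    {z : (cechDouble U S).Tot (k + 1)} {y : (cechDouble U I).Tot k}
    (hz : (cechDouble U S).totD (k + 1) z = 0)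
    (hzy : totMap (cechDoubleMap U η) (k + 1) z = (cechDouble U I).totD k y)
    (h : ∀ j, IsConeBoundary η i k (z ⟨(0, k + 1), zero_add _⟩ j) (y ⟨(0, k), zero_add _⟩ j)) :
    ∃ (v : (cechDouble U S).Tot k) (w : (cechDouble U I).total.X i),
      z = (cechDouble U S).totD k v ∧
        y - totMap (cechDoubleMap U η) k v = (cechDouble U I).total.d i k w := by
  obtain ⟨b, hb⟩ := exists_totD_eq (fun _ _ => eq_zero_of_cone_d_eq_zero)
    (fun p q hq x hx => by
      obtain rfl : q = 0 := by omega
      exact exists_cone_d_eq (by simp) fun j =>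
        (isConeCocycle_of_cone_d_eq_zero hx j).isConeBoundary_zero)
    (conePair (cechDoubleMap U η) z y) (totD_conePair_eq_zero hz hzy)
    (by
      rw [conePair_zero_succ]
      exact exists_cone_d_eq hi h)
  exact exists_eq_totD_of_totD_eq_conePair hi hb

end CechCone

/-- `IsFiltered J` would be too strong: parallel refinement maps are not equalized in the category
of open coverings. -/
lemma exists_colimit_ι_eq {J : Type*} [Category J] [Nonempty J] (G : J ⥤ AddCommGrpCat.{u})
    [HasColimit G] (hJ : ∀ i j : J, ∃ k, Nonempty (i ⟶ k) ∧ Nonempty (j ⟶ k))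
    (a : (colimit G : AddCommGrpCat.{u})) : ∃ j b, colimit.ι G j b = a := by
  let range (j : J) : AddSubgroup (colimit G : AddCommGrpCat.{u}) := (colimit.ι G j).hom.range
  have range_le {i j : J} (f : i ⟶ j) : range i ≤ range j := by
    rintro _ ⟨b, rfl⟩
    exact ⟨G.map f b, ConcreteCategory.congr_hom (colimit.w G f) b⟩
  have directed_range : Directed (· ≤ ·) range := fun i j => by
    obtain ⟨k, ⟨f⟩, ⟨g⟩⟩ := hJ i j
    exact ⟨k, range_le f, range_le g⟩
  have mk_eq_zero : AddCommGrpCat.ofHom (QuotientAddGroup.mk' (⨆ j, range j)) = 0 := by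
    refine colimit.hom_ext fun j => ?_
    ext b
    rw [comp_zero]
    exact (QuotientAddGroup.eq_zero_iff _).2 (le_iSup range j ⟨b, rfl⟩)
  have ha : a ∈ ⨆ j, range j :=
    (QuotientAddGroup.eq_zero_iff _).1 (ConcreteCategory.congr_hom mk_eq_zero a)
  exact (AddSubgroup.mem_iSup_of_directed directed_range).1 ha

namespace OpenCover

variable {X : TopCat.{u}}

/-- The members of the coverings are written as intersections of a single set, since this is how
they index Čech cochains of degree `0`. -/
lemma exists_refinement (𝒰 : OpenCover X)
    (P : ∀ (j : Fin 1 → 𝒰.sets) (V : Opens X), V ≤ inter 𝒰.family j → Prop)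
    (hP : ∀ j {V W} (hV : V ≤ inter 𝒰.family j) (hW : W ≤ V), P j V hV → P j W (hW.trans hV))
    (hloc : ∀ j, ∀ x ∈ inter 𝒰.family j, ∃ V hV, x ∈ V ∧ P j V hV) :
    ∃ (𝒱 : OpenCover X) (f : 𝒱 ⟶ 𝒰), ∀ j : Fin 1 → 𝒱.sets,
      P (f.τ ∘ j) (inter 𝒱.family j) (inter_le_inter f.τ f.le_τ j) := by
  let 𝒱 : OpenCover X :=
    { sets := {V | ∃ (i : 𝒰.sets) (hV : V ≤ inter 𝒰.family (fun _ : Fin 1 => i)), P _ V hV}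
      exists_mem := fun x => by
        obtain ⟨i, hi⟩ := 𝒰.exists_family x
        obtain ⟨V, hV, hx, h⟩ := hloc (fun _ => i) x ((mem_inter _).2 fun _ => hi)
        exact ⟨V, ⟨i, hV, h⟩, hx⟩ }
  choose τ hτ hPτ using fun V : 𝒱.sets => V.2
  refine ⟨𝒱, ⟨τ, fun V x hx => (mem_inter _).1 (hτ V hx) 0⟩, fun j => ?_⟩
  obtain ⟨V, rfl⟩ : ∃ V, j = fun _ => V := ⟨j 0, funext fun a => by rw [Subsingleton.elim a 0]⟩
  exact hP _ (hτ V) (fun x hx => (mem_inter _).1 hx 0) (hPτ V)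

lemma exists_common_refinement (𝒰 𝒱 : OpenCover X) :
    ∃ 𝒲 : OpenCover X, Nonempty (𝒲 ⟶ 𝒰) ∧ Nonempty (𝒲 ⟶ 𝒱) := by
  let 𝒲 : OpenCover X :=
    { sets := {W | ∃ (i : 𝒰.sets) (j : 𝒱.sets), W ≤ 𝒰.family i ∧ W ≤ 𝒱.family j}
      exists_mem := fun x => by
        obtain ⟨i, hi⟩ := 𝒰.exists_family x
        obtain ⟨j, hj⟩ := 𝒱.exists_family x
        exact ⟨𝒰.family i ⊓ 𝒱.family j, ⟨i, j, inf_le_left, inf_le_right⟩, hi, hj⟩ }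
  choose a b ha hb using fun W : 𝒲.sets => W.2
  exact ⟨𝒲, ⟨⟨a, ha⟩⟩, ⟨⟨b, hb⟩⟩⟩

instance : Nonempty (OpenCover X) :=
  ⟨⟨Set.univ, fun _ => ⟨⊤, trivial, trivial⟩⟩⟩

end OpenCover

section Comparison

open DoubleComplex

variable {X : TopCat.{u}} {S I : CochainComplex (TopCat.Sheaf AddCommGrpCat.{u} X) ℕ} {i k : ℕ}

lemma totMap_cechDoubleMap_cechDoubleRefine {ι κ : Type u} {U : ι → Opens X} {V : κ → Opens X}
    (η : S ⟶ I) (τ : κ → ι) (hτ : ∀ k, V k ≤ U (τ k)) (n : ℕ) (z : (cechDouble U S).Tot n) :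
    totMap (cechDoubleMap V η) n (totMap (cechDoubleRefine S τ hτ) n z) =
      totMap (cechDoubleRefine I τ hτ) n (totMap (cechDoubleMap U η) n z) :=
  funext fun a => funext fun _ => app_res (η.f a.1.2) _ _

lemma exists_refinement_eq_totD (η : S ⟶ I) [QuasiIso η] (hk : k ≤ 1)
    (hi : (ComplexShape.up ℕ).prev k = i) {𝒰 : OpenCover X}
    {z : (cechDouble 𝒰.family S).Tot (k + 1)} {y : (cechDouble 𝒰.family I).Tot k}
    (hz : (cechDouble 𝒰.family S).totD (k + 1) z = 0)
    (hzy : totMap (cechDoubleMap 𝒰.family η) (k + 1) z = (cechDouble 𝒰.family I).totD k y) :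
    ∃ (𝒱 : OpenCover X) (f : 𝒱 ⟶ 𝒰) (v : (cechDouble 𝒱.family S).Tot k)
      (w : (cechDouble 𝒱.family I).total.X i),
      totMap (cechDoubleRefine S f.τ f.le_τ) (k + 1) z = (cechDouble 𝒱.family S).totD k v ∧
        totMap (cechDoubleRefine I f.τ f.le_τ) k y - totMap (cechDoubleMap 𝒱.family η) k v =
          (cechDouble 𝒱.family I).total.d i k w := by
  obtain ⟨𝒱, f, hf⟩ := 𝒰.exists_refinement
    (fun j _ hV => IsConeBoundary η i k (res _ hV (z ⟨(0, k + 1), zero_add _⟩ j))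
      (res _ hV (y ⟨(0, k), zero_add _⟩ j)))
    (fun j V W hV hW h => by simpa only [res_res] using h.res hW)
    (fun j => (isConeCocycle_of_totD hz hzy j).exists_isConeBoundary hi)
  obtain ⟨v, w, hv, hw⟩ := exists_eq_totD_of_isConeBoundary (η := η) hk hi
    (z := totMap (cechDoubleRefine S f.τ f.le_τ) (k + 1) z)
    (y := totMap (cechDoubleRefine I f.τ f.le_τ) k y)
    (by rw [totD_totMap, hz, map_zero])
    (by rw [totMap_cechDoubleMap_cechDoubleRefine, hzy, totD_totMap]) hf
  exact ⟨𝒱, f, v, w, hv, hw⟩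

/-- The class in `ℍ^k(𝒰, S^·)` of a cocycle of the total Čech complex. -/
def coverClass {𝒰 : OpenCover X} (z : (cechDouble 𝒰.family S).Tot k)
    (hz : (cechDouble 𝒰.family S).totD k z = 0) : (coverHyper S k).obj (op 𝒰) :=
  homologyClass (cechDouble 𝒰.family S).total z ((total_d_apply z).trans hz)

lemma exists_coverClass_eq {𝒰 : OpenCover X} (a : (coverHyper S k).obj (op 𝒰)) :
    ∃ z hz, coverClass z hz = a := by
  obtain ⟨z, hz, rfl⟩ := exists_homologyClass_eq (M := (cechDouble 𝒰.family S).total) a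
  exact ⟨z, (total_d_apply z).symm.trans hz, rfl⟩

lemma coverClass_eq_iff (hi : (ComplexShape.up ℕ).prev k = i) {𝒰 : OpenCover X}
    {z y : (cechDouble 𝒰.family S).Tot k} (hz : (cechDouble 𝒰.family S).totD k z = 0)
    (hy : (cechDouble 𝒰.family S).totD k y = 0) :
    coverClass z hz = coverClass y hy ↔
      ∃ w : (cechDouble 𝒰.family S).total.X i, z - y = (cechDouble 𝒰.family S).total.d i k w :=
  homologyClass_eq_iff hi _ _ _ _

lemma coverClass_eq_zero_iff (hi : (ComplexShape.up ℕ).prev k = i) {𝒰 : OpenCover X}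
    {z : (cechDouble 𝒰.family S).Tot k} (hz : (cechDouble 𝒰.family S).totD k z = 0) :
    coverClass z hz = 0 ↔
      ∃ w : (cechDouble 𝒰.family S).total.X i, z = (cechDouble 𝒰.family S).total.d i k w :=
  homologyClass_eq_zero_iff hi _ _

lemma coverHyper_map_coverClass {𝒰 𝒱 : OpenCover X} (f : 𝒱 ⟶ 𝒰)
    {z : (cechDouble 𝒰.family S).Tot k} (hz : (cechDouble 𝒰.family S).totD k z = 0) :
    (coverHyper S k).map f.op (coverClass z hz) =
      coverClass (totMap (cechDoubleRefine S f.τ f.le_τ) k z)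
        (by rw [totD_totMap, hz, map_zero]) :=
  homologyMap_homologyClass (totalFunctor.map (cechDoubleRefine S f.τ f.le_τ)) z _

lemma coverHyperMap_coverClass (η : S ⟶ I) {𝒰 : OpenCover X} {z : (cechDouble 𝒰.family S).Tot k}
    (hz : (cechDouble 𝒰.family S).totD k z = 0) :
    (coverHyperMap η k).app (op 𝒰) (coverClass z hz) =
      coverClass (totMap (cechDoubleMap 𝒰.family η) k z) (by rw [totD_totMap, hz, map_zero]) :=
  homologyMap_homologyClass (totalFunctor.map (cechDoubleMap 𝒰.family η)) z _

lemma exists_colimit_ι_coverClass_eq (a : cechHyper S k) :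
    ∃ (𝒰 : OpenCover X) (z : (cechDouble 𝒰.family S).Tot k) (hz : _),
      colimit.ι (coverHyper S k) (op 𝒰) (coverClass z hz) = a := by
  obtain ⟨𝒰, b, rfl⟩ := exists_colimit_ι_eq (coverHyper S k) (fun 𝒰 𝒱 => by
    obtain ⟨𝒲, ⟨f⟩, ⟨g⟩⟩ := OpenCover.exists_common_refinement 𝒰.unop 𝒱.unop
    exact ⟨op 𝒲, ⟨f.op⟩, ⟨g.op⟩⟩) a
  obtain ⟨z, hz, rfl⟩ := exists_coverClass_eq b
  exact ⟨𝒰.unop, z, hz, rfl⟩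

lemma colimit_ι_coverHyper_map {𝒰 𝒱 : OpenCover X} (f : 𝒱 ⟶ 𝒰)
    (a : (coverHyper S k).obj (op 𝒰)) :
    colimit.ι (coverHyper S k) (op 𝒱) ((coverHyper S k).map f.op a) =
      colimit.ι (coverHyper S k) (op 𝒰) a :=
  ConcreteCategory.congr_hom (colimit.w (coverHyper S k) f.op) a

lemma colimit_ι_coverClass_eq_zero (hi : (ComplexShape.up ℕ).prev k = i) {𝒰 : OpenCover X}
    {z : (cechDouble 𝒰.family S).Tot k} (hz : (cechDouble 𝒰.family S).totD k z = 0)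
    {w : (cechDouble 𝒰.family S).total.X i} (hw : z = (cechDouble 𝒰.family S).total.d i k w) :
    colimit.ι (coverHyper S k) (op 𝒰) (coverClass z hz) = 0 :=
  (congrArg _ ((coverClass_eq_zero_iff hi hz).2 ⟨w, hw⟩)).trans
    (map_zero (colimit.ι (coverHyper S k) (op 𝒰)).hom)

variable (R : InjRes S)

lemma coverHyper_map_augIso_hom {𝒰 𝒱 : OpenCover X} (f : 𝒱 ⟶ 𝒰) (b : derivedHyper R k) :
    (coverHyper R.I k).map f.op ((augIso R k 𝒰).hom b) = (augIso R k 𝒱).hom b :=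
  ConcreteCategory.congr_hom ((HomologicalComplex.homologyMap_comp _ _ _).symm.trans
    (congrArg (HomologicalComplex.homologyMap · k) (aug_refine R.I f.τ f.le_τ))) b

lemma coverToDerived_eq_iff (𝒰 : OpenCover X) (a : (coverHyper S k).obj (op 𝒰))
    (b : derivedHyper R k) :
    coverToDerived R k 𝒰 a = b ↔ (coverHyperMap R.η k).app (op 𝒰) a = (augIso R k 𝒰).hom b := by
  constructor
  · rintro rfl
    exact (ConcreteCategory.congr_hom (augIso R k 𝒰).inv_hom_id _).symm
  · intro h
    exact (congrArg (augIso R k 𝒰).inv h).trans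
      (ConcreteCategory.congr_hom (augIso R k 𝒰).hom_inv_id b)

lemma cechToDerived_ι_eq_iff (𝒰 : OpenCover X) (a : (coverHyper S k).obj (op 𝒰))
    (b : derivedHyper R k) :
    cechToDerived R k (colimit.ι (coverHyper S k) (op 𝒰) a) = b ↔
      (coverHyperMap R.η k).app (op 𝒰) a = (augIso R k 𝒰).hom b := by
  rw [← coverToDerived_eq_iff]
  exact Eq.congr_left (ConcreteCategory.congr_hom (colimit.ι_desc _ (op 𝒰)) a)

lemma exists_eq_d_of_cechToDerived_eq_zero (hi : (ComplexShape.up ℕ).prev k = i)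
    {𝒰 : OpenCover X} {z : (cechDouble 𝒰.family S).Tot k}
    {hz : (cechDouble 𝒰.family S).totD k z = 0}
    (h : cechToDerived R k (colimit.ι (coverHyper S k) (op 𝒰) (coverClass z hz)) = 0) :
    ∃ y : (cechDouble 𝒰.family R.I).total.X i,
      totMap (cechDoubleMap 𝒰.family R.η) k z = (cechDouble 𝒰.family R.I).total.d i k y := by
  rwa [cechToDerived_ι_eq_iff, map_zero, coverHyperMap_coverClass, coverClass_eq_zero_iff hi] at h

lemma cechToDerived_injective_zero : Function.Injective (cechToDerived R 0) := by
  have := R.quasiIso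
  rw [injective_iff_map_eq_zero]
  intro a ha
  obtain ⟨𝒰, z, hz, rfl⟩ := exists_colimit_ι_coverClass_eq a
  obtain ⟨y, hzy⟩ := exists_eq_d_of_cechToDerived_eq_zero R (i := 0) (by simp) ha
  rw [HomologicalComplex.shape _ 0 0 (by simp)] at hzy
  exact colimit_ι_coverClass_eq_zero (i := 0) (w := 0) (by simp) hz
    ((eq_zero_of_totMap_cechDoubleMap_eq_zero hz hzy).trans (map_zero _).symm)

lemma cechToDerived_injective_succ (hk : k ≤ 1) :
    Function.Injective (cechToDerived R (k + 1)) := by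
  have := R.quasiIso
  have hprev : (ComplexShape.up ℕ).prev (k + 1) = k := by simp
  rw [injective_iff_map_eq_zero]
  intro a ha
  obtain ⟨𝒰, z, hz, rfl⟩ := exists_colimit_ι_coverClass_eq a
  obtain ⟨y, hzy⟩ := exists_eq_d_of_cechToDerived_eq_zero R hprev ha
  obtain ⟨𝒱, f, v, -, hv, -⟩ :=
    exists_refinement_eq_totD R.η hk rfl hz (hzy.trans (total_d_apply y))
  rw [← colimit_ι_coverHyper_map f, coverHyper_map_coverClass]
  exact colimit_ι_coverClass_eq_zero hprev _ (hv.trans (total_d_apply v).symm)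

lemma cechToDerived_surjective (hk : k ≤ 1) : Function.Surjective (cechToDerived R k) := by
  have := R.quasiIso
  intro b
  let 𝒰 : OpenCover X := Classical.arbitrary _
  obtain ⟨y, hy, hyb⟩ := exists_coverClass_eq ((augIso R k 𝒰).hom b)
  obtain ⟨𝒱, f, v, w, hv, hw⟩ := exists_refinement_eq_totD R.η hk rfl (𝒰 := 𝒰) (z := 0)
    (map_zero _) ((map_zero _).trans hy.symm)
  rw [map_zero] at hv
  refine ⟨colimit.ι (coverHyper S k) (op 𝒱) (coverClass v hv.symm), ?_⟩
  rw [cechToDerived_ι_eq_iff, coverHyperMap_coverClass, ← coverHyper_map_augIso_hom R f, ← hyb,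
    coverHyper_map_coverClass, eq_comm, coverClass_eq_iff rfl]
  exact ⟨w, hw⟩

end Comparison

end CechHyper

end

theorem mainTheorem12 {X : TopCat.{u}}
    (S : CochainComplex (TopCat.Sheaf AddCommGrpCat.{u} X) ℕ) (R : CechHyper.InjRes S) :
    (∀ k : ℕ, k ≤ 1 → Function.Bijective (CechHyper.cechToDerived R k)) ∧
      Function.Injective (CechHyper.cechToDerived R 2) := by
  refine ⟨fun k hk => ⟨?_, CechHyper.cechToDerived_surjective R hk⟩,
    CechHyper.cechToDerived_injective_succ R le_rfl⟩
  cases k with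
  | zero => exact CechHyper.cechToDerived_injective_zero R
  | succ k => exact CechHyper.cechToDerived_injective_succ R (Nat.le_of_succ_le hk)
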